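/- Let $\mathcal A$ be an abelian category and let $P\colon\mathcal A\to\mathcal A$ be an additive functor which is generating, i.e. every object of $\mathcal A$ is a quotient of some object $P(A')$. Let $\nu$ be a Nakayama functor relative to $P$: an additive functor $\nu\colon\mathcal A\to\mathcal A$ with a right adjoint $\nu^-$ such that $I:=\nu\circ P$ is right adjoint to $P$ and the unit $A\to\nu^-\nu(A)$ of $\nu\dashv\nu^-$ is an isomorphism for every object $A$ of the form $P(A')$. An object is called $P$-projective (respectively $I$-injective) if it is a direct summand of some $P(A')$ (respectively $I(A')$). An object $G$ is Gorenstein $P$-projective if there is an exact complex $Q_\bullet=(\cdots\to Q_1\to Q_0\to Q_{-1}\to\cdots)$ of $P$-projective objects such that $\nu(Q_\bullet)$ is exact and $G\cong\operatorname{Ker}(Q_0\to Q_{-1})$; it is Gorenstein $I$-injective if there is an exact complex $J_\bullet=(\cdots\to J_1\to J_0\to J_{-1}\to\cdots)$ of $I$-injective objects such that $\nu^-(J_\bullet)$ is exact and $G\cong\operatorname{Ker}(J_0\to J_{-1})$. The Gorenstein $P$-projective dimension of $A\in\mathcal A$ is the least $n\ge 0$ for which there is an exact sequence $0\to X_n\to\cdots\to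 X_0\to A\to 0$ with all $X_i$ Gorenstein $P$-projective ($\infty$ if there is none), and the Gorenstein $I$-injective dimension of $A$ is the least $n\ge0$ for which there is an exact sequence $0\to A\to Y_0\to\cdots\to Y_n\to 0$ with all $Y_i$ Gorenstein $I$-injective ($\infty$ if there is none). The corresponding global dimensions of $\mathcal A$ are the suprema of these dimensions over all objects $A\in\mathcal A$. Then the total left derived functor $L\nu\colon D^-(\mathcal A)\to D^-(\mathcal A)$ and the total right derived functor $R\nu^-\colon D^+(\mathcal A)\to D^+(\mathcal A)$ exist (no enough projectives or injectives is assumed). Put $L_i\nu(A)=H^{-i}(L\nu(A))$ and $R^i\nu^-(A)=H^i(R\nu^-(A))$, and call $P$ Iwanaga–Gorenstein if there is an $m\ge0$ such that $L_i\nu(A)=0$ and $R^i\nu^-(A)=0$ for all $A\in\mathcal A$ and all $i>m$. The following are equivalent: (a) $P$ is Iwanaga–Gorenstein; (b) the global Gorenstein $P$-projective dimension of $\mathcal A$ is finite; (c) the global Gorenstein $I$-injective dimension of $\mathcal A$ is finite. Moreover, if these conditions hold, then the following four numbers exist and coincide: the global Gorenstein $P$-projective dimension of $\mathcal A$; the global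 Gorenstein $I$-injective dimension of $\mathcal A$; the smallest integer $s\ge0$ such that $L_i\nu(A)=0$ for all $i>s$ and all $A\in\mathcal A$; and the smallest integer $t\ge0$ such that $R^i\nu^-(A)=0$ for all $i>t$ and all $A\in\mathcal A$. -/

import Mathlib

open CategoryTheory CategoryTheory.Limits Opposite

universe w₁ w₂ v₁ v₂ v u₁ u₂ u

namespace NakayamaGorenstein

/-! ### Derived functors without enough injectives or projectives -/

section Derived

variable {C : Type u₁} [Category.{v₁} C] [Abelian C] {D : Type u₂} [Category.{v₂} D] [Abelian D]

/-- The total right derived functor `RF : D⁺(C) ⥤ D⁺(D)` exists: the functor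
`K⁺(C) ⥤ K⁺(D) ⥤ D⁺(D)` induced by `F` has a right derived functor (that is, a left Kan extension
along the localization `K⁺(C) ⥤ D⁺(C)`) with respect to quasi-isomorphisms. -/
abbrev HasRightDerived (F : C ⥤ D) [F.Additive] [HasDerivedCategory.{w₂} D] : Prop :=
  (F.mapHomotopyCategoryPlus ⋙ DerivedCategory.Plus.Qh).HasRightDerivedFunctor
    (HomotopyCategory.Plus.quasiIso C)

variable [HasDerivedCategory.{w₁} C] [HasDerivedCategory.{w₂} D]

/-- The total right derived functor `RF : D⁺(C) ⥤ D⁺(D)`, defined by its universal property. -/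
noncomputable def totalRightDerived (F : C ⥤ D) [F.Additive] [HasRightDerived.{w₂} F] :
    DerivedCategory.Plus C ⥤ DerivedCategory.Plus D :=
  (F.mapHomotopyCategoryPlus ⋙ DerivedCategory.Plus.Qh).totalRightDerived
    DerivedCategory.Plus.Qh (HomotopyCategory.Plus.quasiIso C)

/-- The `i`-th right derived functor `RⁱF : A ↦ Hⁱ(RF(A))`, where the object `A` is regarded as a
complex concentrated in degree `0`. -/
noncomputable def rightDerived (F : C ⥤ D) [F.Additive] [HasRightDerived.{w₂} F] (i : ℕ) : C ⥤ D :=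
  DerivedCategory.Plus.singleFunctor C 0 ⋙ totalRightDerived.{w₁, w₂} F ⋙
    DerivedCategory.Plus.homologyFunctor D (i : ℤ)

end Derived

section LeftDerived

variable {C : Type u₁} [Category.{v₁} C] [Abelian C] {D : Type u₂} [Category.{v₂} D] [Abelian D]

/-- The total left derived functor `LF : D⁻(C) ⥤ D⁻(D)` exists. Since `D⁻(C)` is the opposite of
`D⁺(Cᵒᵖ)`, this functor is the opposite of the total right derived functor of
`Fᵒᵖ : Cᵒᵖ ⥤ Dᵒᵖ`. -/
abbrev HasLeftDerived (F : C ⥤ D) [F.Additive] [HasDerivedCategory.{w₂} Dᵒᵖ] : Prop :=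
  HasRightDerived.{w₂} F.op

/-- The `i`-th left derived functor `LᵢF : A ↦ H⁻ⁱ(LF(A))`; it is the opposite of `Rⁱ(Fᵒᵖ)`. -/
noncomputable def leftDerived [HasDerivedCategory.{w₁} Cᵒᵖ] [HasDerivedCategory.{w₂} Dᵒᵖ]
    (F : C ⥤ D) [F.Additive] [HasLeftDerived.{w₂} F] (i : ℕ) : C ⥤ D :=
  (rightDerived.{w₁, w₂} F.op i).unop

end LeftDerived

variable {A : Type u} [Category.{v} A] [Abelian A]

/-! ### Nakayama functors -/

/-- `P` is generating: every object is a quotient of an object in the image of `P`. -/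
def IsGenerating (P : A ⥤ A) : Prop :=
  ∀ X : A, ∃ (Y : A) (f : P.obj Y ⟶ X), Epi f

/-- A Nakayama functor `ν` relative to `P`, with a right adjoint `ν⁻`, called `νR` here.
Note that `P ⋙ ν` is the composite `ν ∘ P`. -/
structure NakayamaFunctor (P : A ⥤ A) where
  /-- the Nakayama functor `ν` -/
  ν : A ⥤ A
  /-- its right adjoint `ν⁻` -/
  νR : A ⥤ A
  /-- the adjunction `ν ⊣ ν⁻` -/
  adj : ν ⊣ νR
  /-- `ν ∘ P` is right adjoint to `P` -/
  adjI : P ⊣ P ⋙ ν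
  /-- the unit of `ν ⊣ ν⁻` is an isomorphism on objects `P(X)` -/
  isIso_unit : ∀ X : A, IsIso (adj.unit.app (P.obj X))

namespace NakayamaFunctor

variable {P : A ⥤ A} (N : NakayamaFunctor P)

instance ν_additive : N.ν.Additive := by
  have := N.adj.leftAdjoint_preservesColimits
  have := preservesBinaryBiproducts_of_preservesBinaryCoproducts N.ν
  exact Functor.additive_of_preservesBinaryBiproducts N.ν

instance νR_additive : N.νR.Additive := by
  have := N.adj.rightAdjoint_preservesLimits
  have := preservesBinaryBiproducts_of_preservesBinaryProducts N.νR
  exact Functor.additive_of_preservesBinaryBiproducts N.νR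

/-- The functor `I = ν ∘ P`. -/
abbrev I : A ⥤ A := P ⋙ N.ν

end NakayamaFunctor

/-- `X` is a direct summand of an object in the image of `F`. For `F = P` these are the
`P`-projective objects, for `F = I` the `I`-injective objects. -/
def IsSummandOfImage (F : A ⥤ A) : ObjectProperty A :=
  fun X ↦ ∃ Y : A, Nonempty (Retract X (F.obj Y))

/-! ### Gorenstein objects -/

/-- `G` is Gorenstein `P`-projective: there is an exact complex `⋯ ⟶ Q₁ ⟶ Q₀ ⟶ Q₋₁ ⟶ ⋯` of
`P`-projective objects which stays exact under `ν` and has `Ker (Q₀ ⟶ Q₋₁) ≅ G`. -/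
def IsGorensteinProjective {P : A ⥤ A} (N : NakayamaFunctor P) : ObjectProperty A :=
  fun G ↦ ∃ Q : ChainComplex A ℤ,
    (∀ i, IsSummandOfImage P (Q.X i)) ∧ Q.Acyclic ∧
    ((N.ν.mapHomologicalComplex _).obj Q).Acyclic ∧
    Nonempty (kernel (Q.d 0 (-1)) ≅ G)

/-- `G` is Gorenstein `I`-injective: there is an exact complex `⋯ ⟶ J₁ ⟶ J₀ ⟶ J₋₁ ⟶ ⋯` of
`I`-injective objects which stays exact under `ν⁻` and has `Ker (J₀ ⟶ J₋₁) ≅ G`. -/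
def IsGorensteinInjective {P : A ⥤ A} (N : NakayamaFunctor P) : ObjectProperty A :=
  fun G ↦ ∃ J : ChainComplex A ℤ,
    (∀ i, IsSummandOfImage N.I (J.X i)) ∧ J.Acyclic ∧
    ((N.νR.mapHomologicalComplex _).obj J).Acyclic ∧
    Nonempty (kernel (J.d 0 (-1)) ≅ G)

/-! ### Resolution dimensions -/

/-- `HasResolution 𝒳 n X`: there is an exact sequence `0 ⟶ Xₙ ⟶ ⋯ ⟶ X₁ ⟶ X₀ ⟶ X ⟶ 0` with all
`Xᵢ` in `𝒳`, written as a splice of `n` short exact sequences. -/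
inductive HasResolution (𝒳 : ObjectProperty A) : ℕ → A → Prop
  | zero {X₀ X : A} (e : X₀ ≅ X) (h₀ : 𝒳 X₀) : HasResolution 𝒳 0 X
  | succ {n : ℕ} {K X₀ X : A} (i : K ⟶ X₀) (p : X₀ ⟶ X) (w : i ≫ p = 0)
      (hS : (ShortComplex.mk i p w).ShortExact) (h₀ : 𝒳 X₀) (hK : HasResolution 𝒳 n K) :
      HasResolution 𝒳 (n + 1) X

/-- `HasCoresolution 𝒴 n X`: there is an exact sequence `0 ⟶ X ⟶ Y₀ ⟶ Y₁ ⟶ ⋯ ⟶ Yₙ ⟶ 0` with all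
`Yᵢ` in `𝒴`, written as a splice of `n` short exact sequences. -/
inductive HasCoresolution (𝒴 : ObjectProperty A) : ℕ → A → Prop
  | zero {X Y₀ : A} (e : X ≅ Y₀) (h₀ : 𝒴 Y₀) : HasCoresolution 𝒴 0 X
  | succ {n : ℕ} {X Y₀ K : A} (i : X ⟶ Y₀) (p : Y₀ ⟶ K) (w : i ≫ p = 0)
      (hS : (ShortComplex.mk i p w).ShortExact) (h₀ : 𝒴 Y₀) (hK : HasCoresolution 𝒴 n K) :
      HasCoresolution 𝒴 (n + 1) X

/-- The resolution dimension of `X` with respect to `𝒳`: the least `n` such that `X` has a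
resolution of length `n` by objects of `𝒳`, and `⊤` if there is none. -/
noncomputable def resolutionDim (𝒳 : ObjectProperty A) (X : A) : ℕ∞ :=
  ⨅ (n : ℕ) (_ : HasResolution 𝒳 n X), (n : ℕ∞)

/-- The coresolution dimension of `X` with respect to `𝒴`. -/
noncomputable def coresolutionDim (𝒴 : ObjectProperty A) (X : A) : ℕ∞ :=
  ⨅ (n : ℕ) (_ : HasCoresolution 𝒴 n X), (n : ℕ∞)

/-- The global resolution dimension: the supremum of the resolution dimensions of all objects. -/
noncomputable def globalResolutionDim (𝒳 : ObjectProperty A) : ℕ∞ :=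
  ⨆ X : A, resolutionDim 𝒳 X

/-- The global coresolution dimension. -/
noncomputable def globalCoresolutionDim (𝒴 : ObjectProperty A) : ℕ∞ :=
  ⨆ X : A, coresolutionDim 𝒴 X

/-! ### Iwanaga–Gorenstein functors -/

section IwanagaGorenstein

variable [HasDerivedCategory.{w₁} A] [HasDerivedCategory.{w₂} Aᵒᵖ]

/-- `Lᵢν(X) = 0` for all `X` and all `i > s`. -/
def LeftDerivedVanishAbove {P : A ⥤ A} (N : NakayamaFunctor P) [HasLeftDerived.{w₂} N.ν]
    (s : ℕ) : Prop :=
  ∀ i : ℕ, s < i → ∀ X : A, IsZero ((leftDerived.{w₂, w₂} N.ν i).obj X)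

/-- `Rⁱν⁻(X) = 0` for all `X` and all `i > t`. -/
def RightDerivedVanishAbove {P : A ⥤ A} (N : NakayamaFunctor P) [HasRightDerived.{w₁} N.νR]
    (t : ℕ) : Prop :=
  ∀ i : ℕ, t < i → ∀ X : A, IsZero ((rightDerived.{w₁, w₁} N.νR i).obj X)

/-- `P` is Iwanaga–Gorenstein: there is an `m ≥ 0` such that `Lᵢν(X) = 0` and `Rⁱν⁻(X) = 0` for all
objects `X` and all `i > m`. -/
def IsIwanagaGorenstein {P : A ⥤ A} (N : NakayamaFunctor P) [HasLeftDerived.{w₂} N.ν]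
    [HasRightDerived.{w₁} N.νR] : Prop :=
  ∃ m : ℕ, LeftDerivedVanishAbove.{w₂} N m ∧ RightDerivedVanishAbove.{w₁} N m

end IwanagaGorenstein

end NakayamaGorenstein

/-! Since `P ⊣ I = νP` and `P ≅ ν⁻I`, both `P` and `I` are exact; as `P` is generating, the counit
`PI(X) ⟶ X` is epi and the unit `X ⟶ IP(X)` is mono. These functorial covers and embeddings replace
enough projectives and injectives: `P`-projectives are `ν`-acyclic and `I`-injectives are
`ν⁻`-acyclic, so both derived functors exist and their vanishing is a matter of dimension shifting
(`FunctorialEmbedding.isZero_rightDerived_succ_iff`). Passing to `Aᵒᵖ` exchanges `(P, ν)` and `(I,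
ν⁻)` (`NakayamaFunctor.dual`), so only one side has to be argued.

An object `G` is Gorenstein `P`-projective iff `Lᵢν(G) = 0` and `Rⁱν⁻(νG) = 0` for `i > 0` and `G ⟶
ν⁻νG` is an isomorphism (`isGorensteinProjective_iff`). Under these conditions a complete resolution
is spliced from covers of `G` on one side and, on the other, from `ν⁻` applied to an embedding of
`νG` in an `I`-injective.

The heart is that the global Gorenstein `P`-projective dimension is at most `n` iff `Lᵢν` and `Rⁱν⁻`
both vanish for `i > n` (`globalResolutionDim_le_iff`). If `Rⁱν⁻` vanishes for large `i`, all
`ν`-acyclic objects are Gorenstein projective (`isBiacyclic_of_coAcyclic`), hence so are `n`-th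
syzygies when `Lᵢν = 0` for `i > n`. Conversely, finite Gorenstein resolutions bound `Lᵢν` and force
`ν`-acyclic objects to be Gorenstein projective; then `vanish_of_coVanish` carries the bound over to
`Rⁱν⁻`. For that, take an `I`-injective resolution `J` of `X` and `Q = ν⁻J`, so that `νQ ≅ J`. The
map from `Q` to its opcycles in a degree above `n` can be replaced by one into a complex of
Gorenstein projectives in positive degrees. Under `ν` it goes from a complex exact in positive
degrees to one living there, so applying `ν⁻` gives zero on homology in nonnegative degrees; but the
map is injective on homology in the chosen degree.

The criterion is symmetric in the two functors, so by duality it also governs the Gorenstein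
`I`-injective dimension; a finite bound for one functor transfers to the other, whence the four
numbers agree. -/

namespace NakayamaGorenstein

/-! ### Functorial embeddings and vanishing of derived functors -/

section

variable {C : Type u₁} [Category.{v₁} C] [Abelian C]

/-- The part of the snake lemma in which the connecting map vanishes because the left vertical map
has no cokernel. -/
lemma epi_kernel_map {L₁ L₂ : ShortComplex C} (φ : L₁ ⟶ L₂) (h₁ : Epi L₁.g) (h₂ : L₂.Exact)
    (hφ : Epi φ.τ₁) {K₂ K₃ : C} (g : K₂ ⟶ K₃) (i₂ : K₂ ⟶ L₁.X₂) (i₃ : K₃ ⟶ L₁.X₃)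
    (w₂ : i₂ ≫ φ.τ₂ = 0) (hi₂ : (ShortComplex.mk _ _ w₂).Exact) (w₃ : i₃ ≫ φ.τ₃ = 0)
    (hi₃ : Mono i₃) (comm : i₂ ≫ L₁.g = g ≫ i₃) : Epi g := by
  rw [epi_iff_surjective_up_to_refinements]
  intro A z
  obtain ⟨A₁, π₁, _, y, hy⟩ := surjective_up_to_refinements_of_epi L₁.g (z ≫ i₃)
  obtain ⟨A₂, π₂, _, x, hx⟩ := h₂.exact_up_to_refinements (y ≫ φ.τ₂) (by
    rw [Category.assoc, φ.comm₂₃, ← reassoc_of% hy, w₃]; simp)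
  obtain ⟨A₃, π₃, _, x', hx'⟩ := surjective_up_to_refinements_of_epi φ.τ₁ x
  obtain ⟨A₄, π₄, _, k, hk⟩ := hi₂.exact_up_to_refinements (π₃ ≫ π₂ ≫ y - x' ≫ L₁.f) (by
    dsimp
    rw [Preadditive.sub_comp, Category.assoc, Category.assoc, Category.assoc, hx,
      reassoc_of% hx', φ.comm₁₂, sub_self])
  refine ⟨A₄, π₄ ≫ π₃ ≫ π₂ ≫ π₁, inferInstance, k, ?_⟩
  rw [← cancel_mono i₃]
  dsimp at hk
  simp only [Category.assoc, ← comm, ← reassoc_of% hk, Preadditive.sub_comp, L₁.zero, comp_zero,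
    sub_zero, hy]

lemma exists_lift_of_exact {X Y Z : C} {f : X ⟶ Y} {g : Y ⟶ Z} {w : f ≫ g = 0}
    (h : (ShortComplex.mk f g w).Exact) {A : C} (y : A ⟶ Y) (hy : y ≫ g = 0) :
    ∃ (A' : C) (p : A' ⟶ A) (_ : Epi p) (x : A' ⟶ X), p ≫ y = x ≫ f :=
  h.exact_up_to_refinements y hy

variable {D : Type u₂} [Category.{v₂} D] [Abelian D]

lemma map_comp_eq_zero (F : C ⥤ D) [F.Additive] {X Y Z : C} {f : X ⟶ Y} {g : Y ⟶ Z}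
    (w : f ≫ g = 0) : F.map f ≫ F.map g = 0 := by
  rw [← F.map_comp, w, F.map_zero]

/-- A functorial embedding of all objects into objects on which the left exact functor `F`
behaves well: an exact functor `T` with a natural monomorphism `𝟭 ⟶ T`, which splits on the image
of `T`, such that `T ⋙ F` is exact. -/
structure FunctorialEmbedding (F : C ⥤ D) [F.Additive] where
  /-- the exact functor -/
  T : C ⥤ C
  /-- the embedding -/
  η : 𝟭 C ⟶ T
  [additive : T.Additive]
  mono_η (X : C) : Mono (η.app X)
  shortExact_map (S : ShortComplex C) (hS : S.ShortExact) : (S.map T).ShortExact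
  epi_map {X Y : C} (f : X ⟶ Y) [Epi f] : Epi (F.map (T.map f))
  isSplitMono_η (X : C) : IsSplitMono (η.app (T.obj X))

namespace FunctorialEmbedding

attribute [instance] FunctorialEmbedding.additive FunctorialEmbedding.mono_η

variable {F : C ⥤ D} [F.Additive] (E : FunctorialEmbedding F)

/-- The cokernel of the embedding. -/
noncomputable def coker : C ⥤ C := cokernel E.η

/-- The projection to the cokernel of the embedding. -/
noncomputable def π : E.T ⟶ E.coker := cokernel.π E.η

@[simp]
lemma η_π (X : C) : E.η.app X ≫ E.π.app X = 0 :=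
  congr_app (cokernel.condition E.η) X

lemma shortExact (X : C) : (ShortComplex.mk (E.η.app X) (E.π.app X) (E.η_π X)).ShortExact := by
  have h : (ShortComplex.mk E.η E.π (cokernel.condition _)).Exact :=
    ShortComplex.exact_of_g_is_cokernel _ (cokernelIsCokernel _)
  have : Epi (E.π.app X) := by
    have : Epi E.π := inferInstanceAs (Epi (cokernel.π _))
    infer_instance
  exact { exact := h.map ((evaluation C C).obj X), mono_f := E.mono_η X, epi_g := this }

instance (X : C) : Epi (E.π.app X) := (E.shortExact X).epi_g

instance : E.coker.Additive where
  map_add {X Y f g} := by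
    rw [← cancel_epi (E.π.app X)]
    simp [← NatTrans.naturality]

lemma epi_map_coker {X Y : C} (f : X ⟶ Y) [Epi f] [Epi (E.T.map f)] :
    Epi (E.coker.map f) := by
  have : Epi (E.π.app X ≫ E.coker.map f) := by
    rw [← E.π.naturality]; infer_instance
  exact epi_of_epi (E.π.app X) _

/-- The nine lemma for `S ⟶ T(S) ⟶ coker(S)`. Exactness of `coker` is what allows dimension shifting
to be iterated on whole short exact sequences. -/
lemma shortExact_coker {S : ShortComplex C} (hS : S.ShortExact) :
    (S.map E.coker).ShortExact := by
  have hT := (E.shortExact_map S hS).exact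
  have := hS.epi_g
  have := hS.mono_f
  have : Mono (E.T.map S.f) := (E.shortExact_map S hS).mono_f
  have : Epi (E.T.map S.g) := (E.shortExact_map S hS).epi_g
  have n₁ : E.T.map S.f ≫ E.π.app S.X₂ = E.π.app S.X₁ ≫ E.coker.map S.f := E.π.naturality S.f
  have n₂ : E.T.map S.g ≫ E.π.app S.X₃ = E.π.app S.X₂ ≫ E.coker.map S.g := E.π.naturality S.g
  have m₁ : S.f ≫ E.η.app S.X₂ = E.η.app S.X₁ ≫ E.T.map S.f := E.η.naturality S.f
  have m₂ : S.g ≫ E.η.app S.X₃ = E.η.app S.X₂ ≫ E.T.map S.g := E.η.naturality S.g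
  have h₁ : (S.map E.coker).Exact := by
    rw [ShortComplex.exact_iff_exact_up_to_refinements]
    intro A (c : A ⟶ E.coker.obj S.X₂) (hc : c ≫ E.coker.map S.g = 0)
    obtain ⟨A₁, π₁, _, t, ht⟩ := surjective_up_to_refinements_of_epi (E.π.app S.X₂) c
    obtain ⟨A₂, π₂, _, (z : _ ⟶ S.X₃), hz⟩ := exists_lift_of_exact (E.shortExact S.X₃).exact
      (t ≫ E.T.map S.g) (by rw [Category.assoc, n₂, ← reassoc_of% ht, hc, comp_zero])
    obtain ⟨A₃, π₃, _, y, hy⟩ := surjective_up_to_refinements_of_epi S.g z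
    obtain ⟨A₄, π₄, _, (s : _ ⟶ E.T.obj S.X₁), hs⟩ := exists_lift_of_exact (f := E.T.map S.f) hT
      (π₃ ≫ π₂ ≫ t - y ≫ E.η.app S.X₂) (by
        have : (π₃ ≫ π₂ ≫ t - y ≫ E.η.app S.X₂) ≫ E.T.map S.g = 0 := by
          simp only [Preadditive.sub_comp, Category.assoc, ← m₂, ← reassoc_of% hy]
          rw [hz, sub_self]
        exact this)
    refine ⟨A₄, π₄ ≫ π₃ ≫ π₂ ≫ π₁, inferInstance, s ≫ E.π.app S.X₁, ?_⟩
    have : (π₄ ≫ π₃ ≫ π₂ ≫ π₁) ≫ c = (s ≫ E.π.app S.X₁) ≫ E.coker.map S.f := by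
      rw [Category.assoc s, ← n₁, ← reassoc_of% hs]
      simp only [Category.assoc, Preadditive.sub_comp, η_π, comp_zero, sub_zero, ht]
    exact this
  have h₂ : Mono (E.coker.map S.f) := by
    apply Preadditive.mono_of_cancel_zero
    intro A c hc
    obtain ⟨A₁, π₁, _, t, ht⟩ := surjective_up_to_refinements_of_epi (E.π.app S.X₁) c
    obtain ⟨A₂, π₂, _, (y : _ ⟶ S.X₂), hy⟩ := exists_lift_of_exact (E.shortExact S.X₂).exact
      (t ≫ E.T.map S.f) (by rw [Category.assoc, n₁, ← reassoc_of% ht, hc, comp_zero])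
    obtain ⟨A₃, π₃, _, x, hx⟩ := exists_lift_of_exact hS.exact y (by
      rw [← cancel_mono (E.η.app S.X₃)]
      change (y ≫ S.g) ≫ E.η.app S.X₃ = 0 ≫ E.η.app S.X₃
      rw [Category.assoc, m₂, ← reassoc_of% hy, map_comp_eq_zero _ S.zero]
      simp)
    have h : π₃ ≫ π₂ ≫ t = x ≫ E.η.app S.X₁ := by
      rw [← cancel_mono (E.T.map S.f)]
      simp only [Category.assoc, hy, ← m₁, reassoc_of% hx]
    rw [← cancel_epi π₁, ← cancel_epi π₂, ← cancel_epi π₃, ht, reassoc_of% h]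
    simp
  exact { exact := h₁, mono_f := h₂, epi_g := E.epi_map_coker S.g }

/-- The vanishing of the first derived functor of `F` on an object, expressed using the functorial
embedding. -/
def FirstVanish (X : C) : Prop := Epi (F.map (E.π.app X))

/-- The vanishing of the `(i + 1)`-th derived functor of `F` on an object, expressed using the
functorial embedding. -/
def Vanish (E : FunctorialEmbedding F) : ℕ → C → Prop
  | 0, X => E.FirstVanish X
  | i + 1, X => Vanish E i (E.coker.obj X)

/-- The acyclic objects for the functor `F`. -/
def Acyclic : ObjectProperty C := fun X ↦ ∀ i, E.Vanish i X

lemma map_exact_and_mono (F : C ⥤ D) [F.Additive] [PreservesFiniteLimits F] {S : ShortComplex C}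
    (hS : S.ShortExact) : (ShortComplex.mk (F.map S.f) (F.map S.g)
      (map_comp_eq_zero F S.zero)).Exact ∧ Mono (F.map S.f) :=
  F.preservesFiniteLimits_iff_forall_exact_map_and_mono.1 inferInstance S hS

section

variable {E} [PreservesFiniteLimits F] {S : ShortComplex C} (hS : S.ShortExact)

include hS

/-- Snake lemma for `F(T S) ⟶ F(coker S)`: by left exactness the kernels of the columns are the
`F(Sᵢ)`, and the first column is epi by assumption. -/
lemma FirstVanish.epi_map_g (h : E.FirstVanish S.X₁) : Epi (F.map S.g) := by
  obtain ⟨h₁, _⟩ := map_exact_and_mono F (E.shortExact S.X₂)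
  obtain ⟨-, h₂⟩ := map_exact_and_mono F (E.shortExact S.X₃)
  obtain ⟨h₃, _⟩ := map_exact_and_mono F (E.shortExact_coker hS)
  have := hS.epi_g
  refine epi_kernel_map (F.mapShortComplex.map (S.mapNatTrans E.π)) (E.epi_map S.g) h₃ h _
    (F.map (E.η.app S.X₂)) (F.map (E.η.app S.X₃)) (map_comp_eq_zero F (E.η_π _)) h₁
    (map_comp_eq_zero F (E.η_π _)) h₂ ?_
  change F.map (E.η.app S.X₂) ≫ F.map (E.T.map S.g) = F.map S.g ≫ F.map (E.η.app S.X₃)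
  rw [← F.map_comp, ← F.map_comp]
  exact congr_arg _ (E.η.naturality S.g).symm

lemma FirstVanish.shortExact_map (h : E.FirstVanish S.X₁) : (S.map F).ShortExact where
  exact := (map_exact_and_mono F hS).1
  mono_f := (map_exact_and_mono F hS).2
  epi_g := h.epi_map_g hS

/-- In the long exact sequence `F(S₂) ⟶ F(S₃) ⟶ R¹F(S₁) ⟶ R¹F(S₂)`, the last term and the first
cokernel vanish. The chase carries this out without having derived functors yet. -/
lemma FirstVanish.of_epi (h : E.FirstVanish S.X₂) (h' : Epi (F.map S.g)) :
    E.FirstVanish S.X₁ := by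
  have := hS.mono_f
  obtain ⟨h₁, _⟩ := map_exact_and_mono F (E.shortExact_map S hS)
  obtain ⟨h₃, _⟩ := map_exact_and_mono F (E.shortExact S.X₃)
  have : Mono (F.map (E.coker.map S.f)) := (map_exact_and_mono F (E.shortExact_coker hS)).2
  have : Epi (F.map (E.π.app S.X₂)) := h
  have n₁ : E.T.map S.f ≫ E.π.app S.X₂ = E.π.app S.X₁ ≫ E.coker.map S.f := E.π.naturality S.f
  have n₂ : E.T.map S.g ≫ E.π.app S.X₃ = E.π.app S.X₂ ≫ E.coker.map S.g := E.π.naturality S.g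
  have m₂ : S.g ≫ E.η.app S.X₃ = E.η.app S.X₂ ≫ E.T.map S.g := E.η.naturality S.g
  rw [FirstVanish, epi_iff_surjective_up_to_refinements]
  intro A x
  obtain ⟨A₁, π₁, _, y, hy⟩ := surjective_up_to_refinements_of_epi (F.map (E.π.app S.X₂))
    (x ≫ F.map (E.coker.map S.f))
  obtain ⟨A₂, π₂, _, (z : _ ⟶ F.obj S.X₃), hz⟩ := exists_lift_of_exact (f := F.map (E.η.app S.X₃)) h₃
        (y ≫ F.map (E.T.map S.g)) (by
      change (y ≫ F.map (E.T.map S.g)) ≫ F.map (E.π.app S.X₃) = 0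
      rw [Category.assoc, ← F.map_comp, n₂, F.map_comp, ← reassoc_of% hy,
        map_comp_eq_zero F (map_comp_eq_zero E.coker S.zero)]
      simp)
  obtain ⟨A₃, π₃, _, b, hb⟩ := surjective_up_to_refinements_of_epi (F.map S.g) z
  obtain ⟨A₄, π₄, _, (t : _ ⟶ F.obj (E.T.obj S.X₁)), ht⟩ := exists_lift_of_exact (f := F.map (E.T.map S.f)) h₁
    (π₃ ≫ π₂ ≫ y - b ≫ F.map (E.η.app S.X₂)) (by
      change (π₃ ≫ π₂ ≫ y - b ≫ F.map (E.η.app S.X₂)) ≫ F.map (E.T.map S.g) = 0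
      simp only [Preadditive.sub_comp, Category.assoc, ← F.map_comp, ← m₂]
      rw [F.map_comp, ← reassoc_of% hb, sub_eq_zero]
      exact congr_arg _ hz)
  refine ⟨A₄, π₄ ≫ π₃ ≫ π₂ ≫ π₁, inferInstance, t, ?_⟩
  rw [← cancel_mono (F.map (E.coker.map S.f))]
  simp only [Category.assoc]
  rw [← F.map_comp, ← n₁, F.map_comp, ← reassoc_of% ht, hy]
  simp [← F.map_comp]

lemma firstVanish_iff_epi (h : E.FirstVanish S.X₂) :
    E.FirstVanish S.X₁ ↔ Epi (F.map S.g) :=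
  ⟨fun h ↦ h.epi_map_g hS, h.of_epi hS⟩

lemma FirstVanish.X₂ (h₁ : E.FirstVanish S.X₁) (h₃ : E.FirstVanish S.X₃) :
    E.FirstVanish S.X₂ := by
  obtain ⟨h, _⟩ := map_exact_and_mono F (E.shortExact_coker hS)
  have := hS.epi_g
  exact ShortComplex.epi_of_epi_of_epi_of_epi (F.mapShortComplex.map (S.mapNatTrans E.π)) h
    (E.epi_map S.g) h₁ h₃

/-- The hypothesis on `coker S₁` stands for `R²F(S₁) = 0`; this is the segment `R¹F(S₂) ⟶ R¹F(S₃) ⟶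
R²F(S₁)` of the long exact sequence. -/
lemma FirstVanish.X₃ (h₂ : E.FirstVanish S.X₂) (h₁ : E.FirstVanish (E.coker.obj S.X₁)) :
    E.FirstVanish S.X₃ := by
  have : Epi (F.map (E.coker.map S.g)) := h₁.epi_map_g (E.shortExact_coker hS)
  have : Epi (F.map (E.π.app S.X₂)) := h₂
  have h : Epi (F.map (E.T.map S.g) ≫ F.map (E.π.app S.X₃)) := by
    rw [← F.map_comp, E.π.naturality, F.map_comp]
    infer_instance
  exact epi_of_epi (F.map (E.T.map S.g)) (F.map (E.π.app S.X₃))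

lemma FirstVanish.coker_X₁ (h₃ : E.FirstVanish S.X₃) (h₂ : E.FirstVanish (E.coker.obj S.X₂)) :
    E.FirstVanish (E.coker.obj S.X₁) := by
  have := hS.epi_g
  refine h₂.of_epi (E.shortExact_coker hS) ?_
  have : Epi (F.map (E.π.app S.X₃)) := h₃
  have := E.epi_map S.g
  have h : Epi (F.map (E.π.app S.X₂) ≫ F.map (E.coker.map S.g)) := by
    rw [← F.map_comp, ← E.π.naturality, F.map_comp]
    infer_instance
  exact epi_of_epi (F.map (E.π.app S.X₂)) (F.map (E.coker.map S.g))

omit hS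

lemma Vanish.X₂ {i : ℕ} {S : ShortComplex C} (hS : S.ShortExact) (h₁ : E.Vanish i S.X₁)
    (h₃ : E.Vanish i S.X₃) : E.Vanish i S.X₂ := by
  induction i generalizing S with
  | zero => exact FirstVanish.X₂ hS h₁ h₃
  | succ i hi => exact hi (E.shortExact_coker hS) h₁ h₃

lemma Vanish.X₃ {i : ℕ} {S : ShortComplex C} (hS : S.ShortExact) (h₂ : E.Vanish i S.X₂)
    (h₁ : E.Vanish (i + 1) S.X₁) : E.Vanish i S.X₃ := by
  induction i generalizing S with
  | zero => exact FirstVanish.X₃ hS h₂ h₁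
  | succ i hi => exact hi (E.shortExact_coker hS) h₂ h₁

lemma Vanish.X₁ {i : ℕ} {S : ShortComplex C} (hS : S.ShortExact) (h₃ : E.Vanish i S.X₃)
    (h₂ : E.Vanish (i + 1) S.X₂) : E.Vanish (i + 1) S.X₁ := by
  induction i generalizing S with
  | zero => exact FirstVanish.coker_X₁ hS h₃ h₂
  | succ i hi => exact hi (E.shortExact_coker hS) h₃ h₂

include hS

lemma Acyclic.X₂ (h₁ : E.Acyclic S.X₁) (h₃ : E.Acyclic S.X₃) : E.Acyclic S.X₂ :=
  fun i ↦ Vanish.X₂ hS (h₁ i) (h₃ i)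

lemma Acyclic.X₃ (h₁ : E.Acyclic S.X₁) (h₂ : E.Acyclic S.X₂) : E.Acyclic S.X₃ :=
  fun i ↦ Vanish.X₃ hS (h₂ i) (h₁ (i + 1))

lemma Acyclic.shortExact_map (h : E.Acyclic S.X₁) : (S.map F).ShortExact :=
  FirstVanish.shortExact_map hS (h 0)

lemma vanish_succ_X₁_iff (h : E.Acyclic S.X₂) (i : ℕ) :
    E.Vanish (i + 1) S.X₁ ↔ E.Vanish i S.X₃ :=
  ⟨Vanish.X₃ hS (h i), fun h' ↦ Vanish.X₁ hS h' (h (i + 1))⟩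

lemma acyclic_X₁_of_epi (h₂ : E.Acyclic S.X₂) (h₃ : E.Acyclic S.X₃) (h : Epi (F.map S.g)) :
    E.Acyclic S.X₁
  | 0 => (firstVanish_iff_epi hS (h₂ 0)).2 h
  | i + 1 => (vanish_succ_X₁_iff hS h₂ i).2 (h₃ i)

end

lemma FirstVanish.of_retract {E : FunctorialEmbedding F} {X Y : C} (r : Retract X Y)
    (h : E.FirstVanish Y) : E.FirstVanish X := by
  have : Epi (F.map (E.π.app Y)) := h
  have h₁ : F.map (E.T.map r.r) ≫ F.map (E.π.app X) =
      F.map (E.π.app Y) ≫ F.map (E.coker.map r.r) := by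
    rw [← F.map_comp, ← F.map_comp, E.π.naturality]
  have : IsSplitEpi (F.map (E.coker.map r.r)) :=
    ⟨⟨{ section_ := F.map (E.coker.map r.i)
        id := by rw [← F.map_comp, ← E.coker.map_comp, r.retract, E.coker.map_id, F.map_id] }⟩⟩
  have : Epi (F.map (E.T.map r.r) ≫ F.map (E.π.app X)) := by rw [h₁]; infer_instance
  exact epi_of_epi (F.map (E.T.map r.r)) _

lemma Vanish.of_retract {E : FunctorialEmbedding F} {i : ℕ} {X Y : C} (r : Retract X Y)
    (h : E.Vanish i Y) : E.Vanish i X := by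
  induction i generalizing X Y with
  | zero => exact FirstVanish.of_retract r h
  | succ i hi => exact hi (r.map E.coker) h

lemma Acyclic.of_retract {E : FunctorialEmbedding F} {X Y : C} (r : Retract X Y)
    (h : E.Acyclic Y) : E.Acyclic X := fun i ↦ (h i).of_retract r

instance : E.Acyclic.IsClosedUnderIsomorphisms where
  of_iso e h := h.of_retract (Retract.ofIso e.symm)

lemma acyclic_biprod [PreservesFiniteLimits F] {X Y : C} (hX : E.Acyclic X) (hY : E.Acyclic Y) :
    E.Acyclic (X ⊞ Y) :=
  Acyclic.X₂ (S := ShortComplex.mk (biprod.inl : X ⟶ X ⊞ Y) biprod.snd biprod.inl_snd)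
    (ShortComplex.Splitting.ofHasBinaryBiproduct X Y).shortExact hX hY

lemma acyclic_of_isZero {X : C} (hX : IsZero X) : E.Acyclic X := by
  have h (i : ℕ) : ∀ X : C, IsZero X → E.Vanish i X := by
    induction i with
    | zero =>
      intro X hX
      have h := F.map_isZero (E.coker.map_isZero hX)
      exact ⟨fun _ _ _ ↦ h.eq_of_src _ _⟩
    | succ i hi => exact fun X hX ↦ hi _ (E.coker.map_isZero hX)
  exact fun i ↦ h i X hX

lemma isSplitMono_η_of_retract {X Y : C} (r : Retract X (E.T.obj Y)) :
    IsSplitMono (E.η.app X) := by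
  have := E.isSplitMono_η Y
  have h : E.η.app X ≫ E.T.map r.i = r.i ≫ E.η.app (E.T.obj Y) := (E.η.naturality _).symm
  have h' : E.η.app (E.T.obj Y) ≫ retraction (E.η.app (E.T.obj Y)) = 𝟙 (E.T.obj Y) :=
    IsSplitMono.id _
  exact ⟨⟨{ retraction := E.T.map r.i ≫ retraction (E.η.app (E.T.obj Y)) ≫ r.r
            id := by rw [reassoc_of% h, reassoc_of% h', r.retract]; rfl }⟩⟩

lemma exists_section_π {X Y : C} (r : Retract X (E.T.obj Y)) :
    ∃ s : E.coker.obj X ⟶ E.T.obj X, s ≫ E.π.app X = 𝟙 _ := by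
  have := E.isSplitMono_η_of_retract r
  have S := (ShortComplex.Splitting.ofExactOfRetraction _ (E.shortExact X).exact
    (retraction (E.η.app X)) (IsSplitMono.id _) inferInstance)
  exact ⟨S.s, S.s_g⟩

/-- The embedding of `X` splits, so `coker X` is again a retract of `T X` and the induction repeats
with the same hypothesis. -/
lemma acyclic_of_retract {X Y : C} (r : Retract X (E.T.obj Y)) : E.Acyclic X := by
  intro i
  induction i generalizing X Y with
  | zero =>
    obtain ⟨s, hs⟩ := E.exists_section_π r
    have : IsSplitEpi (F.map (E.π.app X)) :=
      ⟨⟨{ section_ := F.map s, id := by rw [← F.map_comp, hs, F.map_id] }⟩⟩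
    have : Epi (F.map (E.π.app X)) := inferInstance
    exact this
  | succ i hi =>
    obtain ⟨s, hs⟩ := E.exists_section_π r
    exact hi ⟨s, E.π.app X, hs⟩

lemma acyclic_T (X : C) : E.Acyclic (E.T.obj X) := E.acyclic_of_retract (Retract.refl _)

end FunctorialEmbedding

end

/-! ### Resolutions of bounded below complexes -/

section

variable {C : Type u₁} [Category.{v₁} C] [Abelian C]

lemma exists_lift_of_isPushout_of_mono {X₁ X₂ X₃ X₄ : C} {t : X₁ ⟶ X₂} {l : X₁ ⟶ X₃}
    {r : X₂ ⟶ X₄} {b : X₃ ⟶ X₄} [Mono l] (h : IsPushout t l r b)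
    {A : C} (x : A ⟶ X₂)
    (y : A ⟶ X₃) (hxy : x ≫ r = y ≫ b) :
    ∃ (A' : C) (p : A' ⟶ A) (_ : Epi p) (z : A' ⟶ X₁), p ≫ x = z ≫ t ∧ p ≫ y = z ≫ l := by
  have w : biprod.lift t (-l) ≫ biprod.desc r b = 0 := by
    rw [biprod.lift_desc, Preadditive.neg_comp, h.w, add_neg_cancel]
  have hex : (ShortComplex.mk _ _ w).Exact := h.exact_shortComplex
  obtain ⟨A', p, hp, z, hz⟩ := exists_lift_of_exact hex (biprod.lift x (-y)) (by
    rw [biprod.lift_desc, Preadditive.neg_comp, hxy, add_neg_cancel])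
  refine ⟨A', p, hp, z, ?_, ?_⟩
  · simpa using hz =≫ biprod.fst
  · simpa using hz =≫ biprod.snd

variable {D : Type u₂} [Category.{v₂} D] [Abelian D] {F : C ⥤ D} [F.Additive]

namespace FunctorialEmbedding

variable (E : FunctorialEmbedding F) (K : CochainComplex C ℕ)

/-- The embedding of the object `X`. -/
def emb (X : C) : X ⟶ E.T.obj X := E.η.app X

instance (X : C) : Mono (E.emb X) := E.mono_η X

/-- An intermediate stage of the construction of a resolution of the complex `K`. -/
structure ResolutionStage (n : ℕ) where
  /-- the object that will be embedded in degree `n` -/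
  W : C
  /-- the map from the complex -/
  κ : K.X n ⟶ W
  /-- the induced differential -/
  δ : W ⟶ K.X (n + 1)
  fac : κ ≫ δ = K.d n (n + 1)
  zero : δ ≫ K.d (n + 1) (n + 2) = 0

namespace ResolutionStage

variable {K}

/-- The next stage, which is a pushout. -/
noncomputable def next {n : ℕ} (s : ResolutionStage K n) : ResolutionStage K (n + 1) where
  W := pushout s.δ (E.emb s.W)
  κ := pushout.inl _ _
  δ := pushout.desc (K.d (n + 1) (n + 2)) 0 (by rw [s.zero, comp_zero])
  fac := pushout.inl_desc _ _ _
  zero := by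
    apply pushout.hom_ext
    · rw [pushout.inl_desc_assoc, comp_zero]; exact K.d_comp_d _ _ _
    · rw [pushout.inr_desc_assoc, comp_zero, zero_comp]

end ResolutionStage

/-- The sequence of stages of the resolution of `K`. -/
noncomputable def resolutionStage : ∀ n, ResolutionStage K n
  | 0 => ⟨K.X 0, 𝟙 _, K.d 0 1, by simp, by simp⟩
  | n + 1 => (resolutionStage n).next E

/-- The map `T Wₙ ⟶ Wₙ₊₁`. -/
noncomputable def resolutionInr (n : ℕ) :
    E.T.obj (E.resolutionStage K n).W ⟶ (E.resolutionStage K (n + 1)).W :=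
  pushout.inr (E.resolutionStage K n).δ (E.emb (E.resolutionStage K n).W)

lemma isPushout_resolutionStage (n : ℕ) :
    IsPushout (E.resolutionStage K n).δ (E.emb (E.resolutionStage K n).W)
      (E.resolutionStage K (n + 1)).κ (E.resolutionInr K n) :=
  IsPushout.of_hasPushout _ _

lemma resolutionInr_δ (n : ℕ) :
    E.resolutionInr K n ≫ (E.resolutionStage K (n + 1)).δ = 0 :=
  pushout.inr_desc _ _ _

lemma resolutionInr_η_inr (n : ℕ) :
    E.resolutionInr K n ≫ E.emb (E.resolutionStage K (n + 1)).W ≫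
      E.resolutionInr K (n + 1) = 0 := by
  have h := (E.isPushout_resolutionStage K (n + 1)).w
  have h' := E.resolutionInr_δ K n =≫ (E.resolutionStage K (n + 2)).κ
  rw [Category.assoc, h, zero_comp] at h'
  exact h'

/-- The resolution of `K`. -/
noncomputable abbrev resolution : CochainComplex C ℕ where
  X n := E.T.obj (E.resolutionStage K n).W
  d := (CochainComplex.of (fun n ↦ E.T.obj (E.resolutionStage K n).W)
    (fun n ↦ E.resolutionInr K n ≫ E.emb (E.resolutionStage K (n + 1)).W)
    (fun n ↦ by
      rw [Category.assoc]
      have := E.resolutionInr_η_inr K n =≫ E.emb (E.resolutionStage K (n + 2)).W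
      simpa using this)).d
  shape i j h := HomologicalComplex.shape _ _ _ h
  d_comp_d' i j k _ _ := HomologicalComplex.d_comp_d _ _ _ _

lemma resolution_d (n : ℕ) : (E.resolution K).d n (n + 1) =
    E.resolutionInr K n ≫ E.emb (E.resolutionStage K (n + 1)).W :=
  CochainComplex.of_d (fun n ↦ E.T.obj (E.resolutionStage K n).W)
    (fun n ↦ E.resolutionInr K n ≫ E.emb (E.resolutionStage K (n + 1)).W) _

/-- The embedding of `K` in its resolution. -/
noncomputable def toResolution : K ⟶ E.resolution K where
  f n := (E.resolutionStage K n).κ ≫ E.emb (E.resolutionStage K n).W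
  comm' := by
    rintro i _ rfl
    have h := (E.isPushout_resolutionStage K i).w
    rw [E.resolution_d]
    have := (E.resolutionStage K i).fac
    rw [← this]
    rw [Category.assoc, Category.assoc, reassoc_of% h]

lemma toResolution_f (n : ℕ) : (E.toResolution K).f n =
    (E.resolutionStage K n).κ ≫ E.emb (E.resolutionStage K n).W := rfl

/-- Locally an element of the pushout `Wₙ` is a sum of one from `Kₙ` and one from `T Wₙ₋₁`; the
latter dies under `δ` and becomes a boundary in the resolution. In degree `0` there is only `K₀`. -/
lemma exists_decomposition_resolutionStage (n : ℕ) {A : C}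
    (z : A ⟶ (E.resolutionStage K n).W) :
    ∃ (A' : C) (p : A' ⟶ A) (_ : Epi p) (a : A' ⟶ K.X n)
      (b : A' ⟶ (E.resolution K).X ((ComplexShape.up ℕ).prev n)),
      p ≫ z ≫ (E.resolutionStage K n).δ = a ≫ K.d n (n + 1) ∧
      p ≫ z ≫ E.emb (E.resolutionStage K n).W =
        a ≫ (E.toResolution K).f n + b ≫ (E.resolution K).d _ n := by
  cases n with
  | zero =>
    refine ⟨A, 𝟙 _, inferInstance, z, 0, by simp [resolutionStage], ?_⟩
    rw [toResolution_f, zero_comp, add_zero, Category.id_comp]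
    exact congrArg (z ≫ ·) (Category.id_comp _).symm
  | succ n =>
    obtain ⟨A', p, hp, a, b, hab⟩ :=
      (E.isPushout_resolutionStage K n).hom_eq_add_up_to_refinements z
    rw [CochainComplex.prev_nat_succ]
    refine ⟨A', p, hp, a, b, ?_, ?_⟩
    · have := hab =≫ (E.resolutionStage K (n + 1)).δ
      rw [Preadditive.add_comp, Category.assoc, Category.assoc, Category.assoc,
        E.resolutionInr_δ, (E.resolutionStage K (n + 1)).fac, comp_zero, add_zero] at this
      exact this
    · have := hab =≫ E.emb (E.resolutionStage K (n + 1)).W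
      rw [Preadditive.add_comp, Category.assoc, Category.assoc, Category.assoc] at this
      rw [toResolution_f, resolution_d]
      exact this

/-- A pushout square gives an exact sequence `Wₙ ⟶ Kₙ₊₁ ⊕ T Wₙ ⟶ Wₙ₊₁`. Hence a cycle of the
resolution in degree `n`, or a cycle of `K` that becomes a boundary, comes locally from `Wₙ`, where
the decomposition above applies. -/
instance quasiIso_toResolution : QuasiIso (E.toResolution K) where
  quasiIsoAt n := by
    rw [quasiIsoAt_iff_isIso_homologyMap]
    have : Mono (HomologicalComplex.homologyMap (E.toResolution K) n) := by
      rw [HomologicalComplex.mono_homologyMap_iff_up_to_refinements _ _ n _ rfl rfl]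
      intro A x hx y hxy
      rw [toResolution_f] at hxy
      cases n with
      | zero =>
        refine ⟨A, 𝟙 _, inferInstance, 0, ?_⟩
        have h1 : (E.resolution K).d ((ComplexShape.up ℕ).prev 0) 0 = 0 :=
          HomologicalComplex.shape _ _ _ (by simp)
        rw [h1, comp_zero] at hxy
        have h2 : x = 0 := by
          rw [← Category.comp_id x]
          exact zero_of_comp_mono (E.emb (K.X 0)) ((Category.assoc _ _ _).trans hxy)
        simp [h2]
      | succ n =>
        revert y
        rw [CochainComplex.prev_nat_succ]
        intro y hxy
        rw [resolution_d, ← Category.assoc, ← Category.assoc] at hxy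
        obtain ⟨A₁, p₁, _, z, hz, -⟩ := exists_lift_of_isPushout_of_mono
          (E.isPushout_resolutionStage K n) x y ((cancel_mono _).1 hxy)
        obtain ⟨A₂, p₂, _, a, b, ha, -⟩ := E.exists_decomposition_resolutionStage K n z
        refine ⟨A₂, p₂ ≫ p₁, inferInstance, a, ?_⟩
        rw [Category.assoc, hz, ha]
    have : Epi (HomologicalComplex.homologyMap (E.toResolution K) n) := by
      rw [HomologicalComplex.epi_homologyMap_iff_up_to_refinements _ _ n (n + 1) rfl (by simp)]
      intro A y hy
      rw [resolution_d, ← Category.assoc] at hy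
      have hy' : (0 : A ⟶ K.X (n + 1)) ≫ (E.resolutionStage K (n + 1)).κ =
          y ≫ E.resolutionInr K n := by
        rw [zero_comp]
        exact (zero_of_comp_mono _ hy).symm
      obtain ⟨A₁, p₁, _, z, hz₀, hz⟩ := exists_lift_of_isPushout_of_mono
        (E.isPushout_resolutionStage K n) _ y hy'
      obtain ⟨A₂, p₂, _, a, b, ha, hb⟩ := E.exists_decomposition_resolutionStage K n z
      refine ⟨A₂, p₂ ≫ p₁, inferInstance, a, ?_, b, ?_⟩
      · rw [← ha, ← hz₀]; simp
      · rw [Category.assoc, hz, hb]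
    exact isIso_of_mono_of_epi _

end FunctorialEmbedding

/-- The map from a bounded below complex to the extension of its restriction. -/
noncomputable def toExtendRestriction (K : CochainComplex C ℤ) (n : ℤ) [K.IsStrictlyGE n] :
    K ⟶ (K.restriction (ComplexShape.embeddingUpIntGE n)).extend
      (ComplexShape.embeddingUpIntGE n) :=
  (ComplexShape.embeddingUpIntGE n).liftExtend (𝟙 _) (by
    rintro j hj i' hi'
    have : IsZero (K.X i') :=
      K.isZero_X_of_isStrictlySupported (ComplexShape.embeddingUpIntGE n) i'
        (fun i ↦ hj.notMem hi' i)
    exact this.eq_of_src _ _)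

instance (K : CochainComplex C ℤ) (n : ℤ) [K.IsStrictlyGE n] :
    IsIso (toExtendRestriction K n) := by
  have (i : ℤ) : IsIso ((toExtendRestriction K n).f i) := by
    by_cases hi : ∃ j, (ComplexShape.embeddingUpIntGE n).f j = i
    · obtain ⟨j, hj⟩ := hi
      exact (ComplexShape.Embedding.isIso_liftExtend_f_iff _ _ _ hj).2
        (inferInstanceAs (IsIso (𝟙 _)))
    · simp only [not_exists] at hi
      exact ⟨0, (K.isZero_X_of_isStrictlySupported _ _ hi).eq_of_src _ _,
        (HomologicalComplex.isZero_extend_X _ _ _ hi).eq_of_src _ _⟩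
  exact HomologicalComplex.Hom.isIso_of_components _

namespace FunctorialEmbedding

variable (E : FunctorialEmbedding F)

lemma exists_quasiIso (K : CochainComplex C ℤ) (n : ℤ) [K.IsStrictlyGE n] :
    ∃ (J : CochainComplex C ℤ) (_ : J.IsStrictlyGE n) (f : K ⟶ J), QuasiIso f ∧
      ∀ i, ∃ Y : C, Nonempty (Retract (J.X i) (E.T.obj Y)) := by
  let e := ComplexShape.embeddingUpIntGE n
  refine ⟨(E.resolution (K.restriction e)).extend e, inferInstance,
    toExtendRestriction K n ≫ HomologicalComplex.extendMap (E.toResolution _) e,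
    inferInstance, fun i ↦ ?_⟩
  by_cases hi : ∃ j, e.f j = i
  · obtain ⟨j, hj⟩ := hi
    exact ⟨_, ⟨Retract.ofIso (HomologicalComplex.extendXIso _ e hj)⟩⟩
  · simp only [not_exists] at hi
    -- Outside the range of the extension the term is zero, a retract of anything; `K.X 0` is an
    -- arbitrary choice.
    exact ⟨K.X 0, ⟨⟨0, 0, (HomologicalComplex.isZero_extend_X _ _ _ hi).eq_of_src _ _⟩⟩⟩

end FunctorialEmbedding

end

/-! ### Derivability structures from triangulated subcategories -/

section

open Pretriangulated

variable {𝒯 : Type u₁} [Category.{v₁} 𝒯] [HasZeroObject 𝒯] [HasShift 𝒯 ℤ] [Preadditive 𝒯]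
  [∀ n : ℤ, (shiftFunctor 𝒯 n).Additive] [Pretriangulated 𝒯] [IsTriangulated 𝒯]
  {A B : ObjectProperty 𝒯} [A.IsTriangulated] [B.IsTriangulated] [B.IsClosedUnderIsomorphisms]

/-- A cone of `f` can be chosen in `A`, and any cone of `f` lies in `B`. -/
lemma trW_inf {X Y : 𝒯} {f : X ⟶ Y} (hX : A X) (hY : A Y) (hf : B.trW f) : (A ⊓ B).trW f := by
  obtain ⟨Z, hZ, b, c, h⟩ := A.distinguished_cocone_triangle f hX hY
  exact ⟨Z, b, c, h, hZ, (B.trW_iff_of_distinguished _ h).1 hf⟩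

variable (hAB : ∀ X : 𝒯, ∃ (Y : 𝒯) (f : X ⟶ Y), A Y ∧ B.trW f)

include hAB

lemma isVerdierRightLocalizing_of_resolutions : A.IsVerdierRightLocalizing B := by
  rw [ObjectProperty.isVerdierRightLocalizing_iff]
  intro X Y s hX hs
  obtain ⟨Z, b, hZ, hb⟩ := hAB Y
  exact ⟨Z, s ≫ b, b, hZ, trW_inf hX hZ (B.trW.comp_mem _ _ hs hb), rfl⟩

/-- The Verdier localizing property makes the functor between the quotients fully faithful;
resolutions make it essentially surjective. -/
lemma isLocalizedEquivalence_of_resolutions :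
    (A.triangulatedLocalizerMorphism B).IsLocalizedEquivalence := by
  have := isVerdierRightLocalizing_of_resolutions hAB
  let Φ := A.triangulatedLocalizerMorphism B
  let G := Φ.localizedFunctor (B.inverseImage A.ι).trW.Q B.trW.Q
  have : G.EssSurj := ⟨fun X ↦ by
    obtain ⟨Y, f, hY, hf⟩ := hAB (B.trW.Q.objPreimage X)
    exact ⟨(B.inverseImage A.ι).trW.Q.obj ⟨Y, hY⟩,
      ⟨((CatCommSq.iso Φ.functor (B.inverseImage A.ι).trW.Q B.trW.Q G).app ⟨Y, hY⟩).symm ≪≫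
        (Localization.isoOfHom B.trW.Q B.trW f hf).symm ≪≫ B.trW.Q.objObjPreimageIso X⟩⟩⟩
  have : G.IsEquivalence := { }
  exact ⟨this⟩

lemma hasRightResolutions_arrow_of_resolutions :
    (A.triangulatedLocalizerMorphism B).arrow.HasRightResolutions := by
  intro f
  obtain ⟨X', r, hX', hr⟩ := hAB f.left
  obtain ⟨ψ, hψ⟩ := (MorphismProperty.RightFraction.mk r hr f.hom).exists_leftFraction
  obtain ⟨Y', s, hY', hs⟩ := hAB ψ.Y'
  let X₁ : A.FullSubcategory := ⟨X', hX'⟩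
  let Y₁ : A.FullSubcategory := ⟨Y', hY'⟩
  let g : X₁ ⟶ Y₁ := A.homMk (ψ.f ≫ s)
  exact ⟨{
    X₁ := Arrow.mk g
    w := Arrow.homMk r (ψ.s ≫ s) (by
      change r ≫ ψ.f ≫ s = f.hom ≫ ψ.s ≫ s
      rw [← Category.assoc, ← Category.assoc, hψ])
    hw := ⟨hr, B.trW.comp_mem _ _ ψ.hs hs⟩ }⟩

/-- Two resolutions are completed to a square by the Ore condition, and resolving its corner gives a
third one receiving maps from both. -/
lemma isConnected_rightResolution_of_resolutions (X : 𝒯) :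
    IsConnected ((A.triangulatedLocalizerMorphism B).RightResolution X) := by
  have : Nonempty ((A.triangulatedLocalizerMorphism B).RightResolution X) := by
    obtain ⟨Y, f, hY, hf⟩ := hAB X
    exact ⟨{ X₁ := ⟨Y, hY⟩, w := f, hw := hf }⟩
  apply zigzag_isConnected
  intro R R'
  obtain ⟨ψ, hψ⟩ := (MorphismProperty.RightFraction.mk R'.w R'.hw R.w).exists_leftFraction
  obtain ⟨Z, s, hZ, hs⟩ := hAB ψ.Y'
  let R'' : (A.triangulatedLocalizerMorphism B).RightResolution X :=
    { X₁ := ⟨Z, hZ⟩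
      w := R.w ≫ ψ.s ≫ s
      hw := B.trW.comp_mem _ _ R.hw (B.trW.comp_mem _ _ ψ.hs hs) }
  let f : R ⟶ R'' :=
    { f := A.homMk (ψ.s ≫ s)
      comm := rfl }
  let f' : R' ⟶ R'' :=
    { f := A.homMk (ψ.f ≫ s)
      comm := by
        change R'.w ≫ ψ.f ≫ s = R.w ≫ ψ.s ≫ s
        rw [← Category.assoc, ← Category.assoc, hψ] }
  exact (Zigzag.of_hom f).trans (Zigzag.of_inv f')

lemma isRightDerivabilityStructure_of_resolutions :
    (A.triangulatedLocalizerMorphism B).IsRightDerivabilityStructure := by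
  have := isLocalizedEquivalence_of_resolutions hAB
  have := hasRightResolutions_arrow_of_resolutions hAB
  have := isConnected_rightResolution_of_resolutions hAB
  exact .mk' _

end

/-! ### Exactness of complexes and short exact sequences of cycles -/

section

variable {C : Type u₁} [Category.{v₁} C] [Abelian C]

/-- A composite of an epimorphism, a short exact pair and a monomorphism gives an exact pair. -/
lemma exact_of_factorization {X₁ Z X₂ Z' X₃ : C} {f : X₁ ⟶ X₂} {g : X₂ ⟶ X₃} (w : f ≫ g = 0)
    (p : X₁ ⟶ Z) (i : Z ⟶ X₂) (q : X₂ ⟶ Z') (j : Z' ⟶ X₃) (hf : p ≫ i = f) (hg : q ≫ j = g)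
    {w' : i ≫ q = 0} (h : (ShortComplex.mk i q w').Exact) [Epi p] [Mono j] :
    (ShortComplex.mk f g w).Exact := by
  rw [ShortComplex.exact_iff_exact_up_to_refinements]
  intro A (x : A ⟶ X₂) (hx : x ≫ g = 0)
  obtain ⟨A₁, π₁, _, (y : _ ⟶ Z), hy⟩ := exists_lift_of_exact h x (by
    rw [← cancel_mono j, Category.assoc, hg, hx, zero_comp])
  obtain ⟨A₂, π₂, _, z, hz⟩ := surjective_up_to_refinements_of_epi p y
  refine ⟨A₂, π₂ ≫ π₁, inferInstance, z, ?_⟩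
  have : (π₂ ≫ π₁) ≫ x = z ≫ f := by
    rw [← hf, ← reassoc_of% hz, Category.assoc, hy]
  exact this

section

variable {ι : Type*} {c : ComplexShape ι} (K : HomologicalComplex C c) {i j k : ι}

lemma iCycles_toCycles (i j : ι) : K.iCycles i ≫ K.toCycles i j = 0 := by
  rw [← cancel_mono (K.iCycles j), Category.assoc, K.toCycles_i, K.iCycles_d, zero_comp]

lemma exact_iCycles_toCycles (hij : c.Rel i j) :
    (ShortComplex.mk _ _ (iCycles_toCycles K i j)).Exact := by
  rw [ShortComplex.exact_iff_exact_up_to_refinements]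
  intro A (x : A ⟶ K.X i) (hx : x ≫ K.toCycles i j = 0)
  refine ⟨A, 𝟙 A, inferInstance, K.liftCycles x j (c.next_eq' hij) ?_, ?_⟩
  · rw [← K.toCycles_i, reassoc_of% hx, zero_comp]
  · rw [Category.id_comp]
    exact (K.liftCycles_i x j (c.next_eq' hij) _).symm

lemma exactAt_iff_epi_toCycles (hij : c.Rel i j) : K.ExactAt j ↔ Epi (K.toCycles i j) := by
  obtain rfl := c.prev_eq' hij
  exact ShortComplex.exact_iff_epi_toCycles _

lemma shortExact_cycles (hij : c.Rel i j) (h : K.ExactAt j) :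
    (ShortComplex.mk _ _ (iCycles_toCycles K i j)).ShortExact where
  exact := exact_iCycles_toCycles K hij
  mono_f := inferInstanceAs (Mono (K.iCycles i))
  epi_g := (exactAt_iff_epi_toCycles K hij).1 h

/-- The cycles in degree `0` of a resolution of an object. -/
noncomputable def cyclesIsoOfQuasiIso {X : C} {J : CochainComplex C ℤ} [J.IsStrictlyGE 0]
    (f : (CochainComplex.singleFunctor C 0).obj X ⟶ J) [QuasiIso f] : J.cycles 0 ≅ X :=
  have : IsIso (J.homologyπ 0) :=
    J.isIso_homologyπ (-1) 0 (by simp) ((J.isZero_of_isStrictlyGE 0 _).eq_of_src _ _)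
  asIso (J.homologyπ 0) ≪≫ (asIso (HomologicalComplex.homologyMap f 0)).symm ≪≫
    HomologicalComplex.singleObjHomologySelfIso _ _ _

variable {D : Type u₂} [Category.{v₂} D] [Abelian D] (F : C ⥤ D) [F.Additive]
  [PreservesFiniteLimits F]

lemma exact_map_of_leftExact {X Y Z : C} {f : X ⟶ Y} {g : Y ⟶ Z} {w : f ≫ g = 0}
    (h : (ShortComplex.mk f g w).Exact) [Mono f] :
    (ShortComplex.mk (F.map f) (F.map g) (map_comp_eq_zero F w)).Exact :=
  ShortComplex.Exact.map_of_mono_of_preservesKernel h F inferInstance inferInstance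

lemma exactAt_map_of_epi (hij : c.Rel i j) (hjk : c.Rel j k) (h : Epi (F.map (K.toCycles i j))) :
    ((F.mapHomologicalComplex c).obj K).ExactAt j := by
  rw [HomologicalComplex.exactAt_iff' _ i j k (c.prev_eq' hij) (c.next_eq' hjk)]
  exact exact_of_factorization (f := F.map (K.d i j)) (g := F.map (K.d j k))
    (map_comp_eq_zero F (K.d_comp_d _ _ _)) (F.map (K.toCycles i j)) (F.map (K.iCycles j))
    (F.map (K.toCycles j k)) (F.map (K.iCycles k)) (by rw [← F.map_comp, K.toCycles_i])
    (by rw [← F.map_comp, K.toCycles_i])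
    (exact_map_of_leftExact F (exact_iCycles_toCycles K hjk))

/-- By left exactness `F(Zʲ)` is the object of cycles of `F(K)` in degree `j`, so exactness there
only asks that `F(Kⁱ)` surjects onto it. -/
lemma exactAt_map_iff_epi (hij : c.Rel i j) (hjk : c.Rel j k) :
    ((F.mapHomologicalComplex c).obj K).ExactAt j ↔ Epi (F.map (K.toCycles i j)) := by
  refine ⟨fun h ↦ ?_, exactAt_map_of_epi K F hij hjk⟩
  rw [HomologicalComplex.exactAt_iff' _ i j k (c.prev_eq' hij) (c.next_eq' hjk)] at h
  have h' : (ShortComplex.mk (F.map (K.d i j)) (F.map (K.d j k))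
    (map_comp_eq_zero F (K.d_comp_d _ _ _))).Exact := h
  rw [epi_iff_surjective_up_to_refinements]
  intro A y
  obtain ⟨A', π, hπ, x, hx⟩ := exists_lift_of_exact h' (y ≫ F.map (K.iCycles j)) (by
    rw [Category.assoc, ← F.map_comp, K.iCycles_d, F.map_zero, comp_zero])
  refine ⟨A', π, hπ, x, ?_⟩
  rw [← cancel_mono (F.map (K.iCycles j)), Category.assoc, Category.assoc, hx, ← F.map_comp,
    K.toCycles_i]

end

/-! ### Existence of the right derived functor -/

variable {D : Type u₂} [Category.{v₂} D] [Abelian D] {F : C ⥤ D} [F.Additive]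

namespace FunctorialEmbedding

variable (E : FunctorialEmbedding F)

/-- Boundedness starts an upward induction: the cycles vanish in degree `n`, and `Zⁱ ⟶ Kⁱ ⟶ Zⁱ⁺¹`
passes acyclicity on to all later cycles. -/
lemma acyclic_map_of_acyclic [PreservesFiniteLimits F] (K : CochainComplex C ℤ) (n : ℤ)
    [K.IsStrictlyGE n] (hK : K.Acyclic) (h : ∀ i, E.Acyclic (K.X i)) :
    ((F.mapHomologicalComplex (.up ℤ)).obj K).Acyclic := by
  have rel (i : ℤ) : (ComplexShape.up ℤ).Rel i (i + 1) := by simp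
  have hc (k : ℕ) : E.Acyclic (K.cycles (n + k)) := by
    induction k with
    | zero =>
      have : Epi (K.toCycles (n - 1) n) := (exactAt_iff_epi_toCycles K (by simp)).1 (hK n)
      have : IsZero (K.cycles n) :=
        IsZero.of_epi (K.toCycles (n - 1) n) (K.isZero_of_isStrictlyGE n _)
      simpa using E.acyclic_of_isZero this
    | succ k hk =>
      have := Acyclic.X₃ (shortExact_cycles K (rel (n + k)) (hK _)) hk (h _)
      rwa [add_assoc] at this
  have hc' (i : ℤ) : E.Acyclic (K.cycles i) := by
    by_cases hi : n ≤ i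
    · obtain ⟨k, rfl⟩ := Int.le.dest hi
      exact hc k
    · exact E.acyclic_of_isZero (IsZero.of_mono (K.iCycles i) (K.isZero_of_isStrictlyGE n _))
  intro i
  refine exactAt_map_of_epi K F (i := i - 1) (k := i + 1) (by simp) (by simp) ?_
  exact (Acyclic.shortExact_map
    (shortExact_cycles K (i := i - 1) (j := i) (by simp) (hK i)) (hc' _)).epi_g

/-- The bounded below complexes with acyclic terms. -/
def termwiseAcyclic : ObjectProperty (HomotopyCategory.Plus C) :=
  fun K ↦ ∀ n, E.Acyclic (K.obj.as.X n)

open Pretriangulated in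
instance [PreservesFiniteLimits F] : E.termwiseAcyclic.IsTriangulatedClosed₃ where
  ext₃' T hT h₁ h₂ := by
    obtain ⟨n₁, _⟩ : (CochainComplex.plus C) T.obj₁.obj.as := by
      rw [← HomotopyCategory.plus_quotient_obj_iff]; exact T.obj₁.property
    obtain ⟨n₂, _⟩ : (CochainComplex.plus C) T.obj₂.obj.as := by
      rw [← HomotopyCategory.plus_quotient_obj_iff]; exact T.obj₂.property
    obtain ⟨f : T.obj₁.obj.as ⟶ T.obj₂.obj.as, hf⟩ :=
      (HomotopyCategory.quotient _ _).map_surjective T.mor₁.hom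
    have hT' := (HomotopyCategory.Plus.ι C).map_distinguished _ hT
    have hM : HomotopyCategory.plus C ((HomotopyCategory.quotient _ _).obj
        (CochainComplex.mappingCone f)) := by
      simp only [HomotopyCategory.plus_quotient_obj_iff]
      exact ⟨min (n₁ - 1) n₂, CochainComplex.isStrictlyGE_mappingCone f n₁ n₂ _
        (by simp) (by simp)⟩
    -- Termwise acyclicity is not invariant under homotopy equivalence, so the third vertex is only
    -- isomorphic to an object with the property: the mapping cone of a chain map lifting `mor₁`.
    refine ⟨⟨_, hM⟩, fun n ↦ ?_, ⟨(HomotopyCategory.Plus.ι C).preimageIso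
      (Triangle.π₃.mapIso (isoTriangleOfIso₁₂ _ _ hT'
        (HomotopyCategory.mappingCone_triangleh_distinguished f)
        (Iso.refl _) (Iso.refl _) ?_))⟩⟩
    · exact E.Acyclic.prop_of_iso (HomologicalComplex.homotopyCofiber.XIsoBiprod f n (n + 1) rfl).symm
        (E.acyclic_biprod (h₁ _) (h₂ _))
    · exact (Category.comp_id _).trans (hf.symm.trans (Category.id_comp _).symm)

open ZeroObject in
instance : E.termwiseAcyclic.ContainsZero where
  exists_zero := by
    refine ⟨⟨(HomotopyCategory.quotient _ _).obj 0, ?_⟩, ?_, fun n ↦ ?_⟩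
    · simp only [HomotopyCategory.plus_quotient_obj_iff]
      exact ⟨0, inferInstance⟩
    · rw [IsZero.iff_id_eq_zero]
      ext
      exact (Functor.map_isZero (HomotopyCategory.quotient C (.up ℤ)) (isZero_zero _)).eq_of_src _ _
    · exact E.acyclic_of_isZero
        ((HomologicalComplex.eval C (.up ℤ) n).map_isZero (isZero_zero _))

instance : E.termwiseAcyclic.IsStableUnderShift ℤ where
  isStableUnderShiftBy a :=
    { le_shift := by
        intro K hK
        obtain ⟨⟨K, _⟩, rfl⟩ := HomotopyCategory.Plus.quotient_obj_surjective K
        have h : ∀ n, E.Acyclic (((shiftFunctor (HomotopyCategory C (.up ℤ)) a).obj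
            ((HomotopyCategory.quotient _ _).obj K)).as.X n) := by
          rw [HomotopyCategory.shift_quotient_obj]
          exact fun n ↦ hK (n + a)
        have h' (L : HomotopyCategory C (.up ℤ)) (hL : L = (shiftFunctor _ a).obj
            ((HomotopyCategory.quotient _ _).obj K)) : ∀ n, E.Acyclic (L.as.X n) := by
          subst hL; exact h
        exact h' _ (by with_unfolding_all rfl) }

instance [PreservesFiniteLimits F] : E.termwiseAcyclic.IsTriangulated where
  toIsTriangulatedClosed₂ := .of_isTriangulatedClosed₃

lemma exists_termwiseAcyclic (K : HomotopyCategory.Plus C) :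
    ∃ (J : HomotopyCategory.Plus C) (f : K ⟶ J), E.termwiseAcyclic J ∧
      (HomotopyCategory.Plus.subcategoryAcyclic C).trW f := by
  obtain ⟨⟨K, n, _⟩, rfl⟩ := HomotopyCategory.Plus.quotient_obj_surjective K
  obtain ⟨J, hJ, f, hf, h⟩ := E.exists_quasiIso K n
  refine ⟨(HomotopyCategory.Plus.quotient C).obj ⟨J, n, hJ⟩,
    (HomotopyCategory.Plus.quotient C).map (ObjectProperty.homMk f), fun i ↦ ?_, ?_⟩
  · obtain ⟨Y, ⟨r⟩⟩ := h i
    exact E.acyclic_of_retract r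
  · rw [← HomotopyCategory.Plus.quasiIso_eq_subcategoryAcyclic_trW,
      HomotopyCategory.Plus.quasiIso_iff]
    exact (HomotopyCategory.quotient_map_mem_quasiIso_iff f).2 hf

variable [PreservesFiniteLimits F]

instance : (E.termwiseAcyclic.triangulatedLocalizerMorphism
    (HomotopyCategory.Plus.subcategoryAcyclic C)).IsRightDerivabilityStructure :=
  isRightDerivabilityStructure_of_resolutions E.exists_termwiseAcyclic

/-- The cone of a quasi-isomorphism is an acyclic bounded below complex with acyclic terms, and `F`
keeps it acyclic. -/
lemma derives [HasDerivedCategory.{w₂} D] : (E.termwiseAcyclic.triangulatedLocalizerMorphism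
    (HomotopyCategory.Plus.subcategoryAcyclic C)).Derives
      (F.mapHomotopyCategoryPlus ⋙ DerivedCategory.Plus.Qh) := by
  intro K L f hf
  rw [ObjectProperty.trW_inverseImage_ι_iff] at hf
  obtain ⟨Z, a, b, h, hZ, hZ'⟩ := hf
  apply Localization.inverts DerivedCategory.Plus.Qh (HomotopyCategory.Plus.quasiIso D)
  rw [HomotopyCategory.Plus.quasiIso_eq_subcategoryAcyclic_trW]
  refine ⟨_, _, _, F.mapHomotopyCategoryPlus.map_distinguished _ h, ?_⟩
  obtain ⟨⟨Z, n, _⟩, rfl⟩ := HomotopyCategory.Plus.quotient_obj_surjective Z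
  exact (HomotopyCategory.quotient_obj_mem_subcategoryAcyclic_iff_acyclic _).2
    (E.acyclic_map_of_acyclic Z n
      ((HomotopyCategory.quotient_obj_mem_subcategoryAcyclic_iff_acyclic _).1 hZ') hZ)

include E in
lemma hasRightDerived [HasDerivedCategory.{w₂} D] : HasRightDerived.{w₂} F := by
  have := E.derives.hasPointwiseRightDerivedFunctor
  rw [← HomotopyCategory.Plus.quasiIso_eq_subcategoryAcyclic_trW] at this
  infer_instance

/-- Dimension shifting along `Zʲ ⟶ Jʲ ⟶ Zʲ⁺¹`; the `+ 1` in the degree reflects that `Vanish i`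
stands for the derived functor of index `i + 1`. -/
lemma vanish_cycles_iff (J : CochainComplex C ℤ) (hJ : ∀ n, E.Acyclic (J.X n))
    (hJ' : ∀ n : ℤ, 0 < n → J.ExactAt n) (i j : ℕ) :
    E.Vanish i (J.cycles j) ↔
      ((F.mapHomologicalComplex (.up ℤ)).obj J).ExactAt (j + i + 1 : ℤ) := by
  have S := shortExact_cycles J (i := j) (j := j + 1) (by simp) (hJ' _ (by lia))
  induction i generalizing j with
  | zero =>
    rw [show (j + (0 : ℕ) + 1 : ℤ) = j + 1 by simp,
      exactAt_map_iff_epi J F (i := j) (k := j + 1 + 1) (by simp) (by simp)]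
    exact firstVanish_iff_epi S (hJ _ 0)
  | succ i hi =>
    rw [vanish_succ_X₁_iff S (hJ _)]
    have := hi (j + 1) (shortExact_cycles J (by simp) (hJ' _ (by lia)))
    rw [show (j + (i + 1 : ℕ) + 1 : ℤ) = (j + 1 : ℕ) + i + 1 by push_cast; ring]
    exact this

section

variable [HasDerivedCategory.{w₁} C] [HasDerivedCategory.{w₂} D] [HasRightDerived.{w₂} F]

include E in
-- The derivability structure makes the unit `F(J) ⟶ RF(J)` an isomorphism on complexes with acyclic
-- terms, so such resolutions compute `RF`.
lemma nonempty_rightDerived_iso (X : C) (J : CochainComplex C ℤ) [J.IsStrictlyGE 0]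
    (f : (CochainComplex.singleFunctor C 0).obj X ⟶ J) [QuasiIso f]
    (hJ : ∀ n, E.Acyclic (J.X n)) (i : ℕ) :
    Nonempty ((rightDerived.{w₁, w₂} F i).obj X ≅
      ((F.mapHomologicalComplex (.up ℤ)).obj J).homology i) := by
  let K₀ : CochainComplex.Plus C := ⟨(CochainComplex.singleFunctor C 0).obj X, 0, inferInstance⟩
  let J₀ : CochainComplex.Plus C := ⟨J, 0, inferInstance⟩
  let f₀ : K₀ ⟶ J₀ := ObjectProperty.homMk f
  let K₁ := (HomotopyCategory.Plus.quotient C).obj K₀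
  let J₁ := (HomotopyCategory.Plus.quotient C).obj J₀
  let f₁ : K₁ ⟶ J₁ := (HomotopyCategory.Plus.quotient C).map f₀
  let G := F.mapHomotopyCategoryPlus ⋙ DerivedCategory.Plus.Qh
  let α : G ⟶ DerivedCategory.Plus.Qh ⋙ totalRightDerived.{w₁, w₂} F :=
    G.totalRightDerivedUnit DerivedCategory.Plus.Qh (HomotopyCategory.Plus.quasiIso C)
  have hα : IsIso (α.app J₁) := by
    have h : (totalRightDerived.{w₁, w₂} F).IsRightDerivedFunctor α
        (HomotopyCategory.Plus.quasiIso C) :=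
      inferInstanceAs ((G.totalRightDerived DerivedCategory.Plus.Qh
        (HomotopyCategory.Plus.quasiIso C)).IsRightDerivedFunctor _
        (HomotopyCategory.Plus.quasiIso C))
    have : (totalRightDerived.{w₁, w₂} F).IsRightDerivedFunctor α
        (HomotopyCategory.Plus.subcategoryAcyclic C).trW := ⟨h.isLeftKanExtension⟩
    exact E.derives.isIso_of_isRightDerivedFunctor α ⟨J₁, hJ⟩
  have hf₁ : IsIso (DerivedCategory.Plus.Qh.map f₁) := by
    apply Localization.inverts DerivedCategory.Plus.Qh (HomotopyCategory.Plus.quasiIso C)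
    rw [HomotopyCategory.Plus.quasiIso_iff]
    exact (HomotopyCategory.quotient_map_mem_quasiIso_iff f).2 ‹QuasiIso f›
  let e₀ : (DerivedCategory.Plus.singleFunctor C 0).obj X ≅ DerivedCategory.Plus.Qh.obj K₁ :=
    DerivedCategory.Plus.ι.preimageIso (Iso.refl _)
  let H := DerivedCategory.Plus.homologyFunctor D (i : ℤ)
  let e₁ : (rightDerived.{w₁, w₂} F i).obj X ≅ H.obj (G.obj J₁) :=
    H.mapIso ((totalRightDerived.{w₁, w₂} F).mapIso
      (e₀ ≪≫ asIso (DerivedCategory.Plus.Qh.map f₁)) ≪≫ (asIso (α.app J₁)).symm)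
  let e₂ : H.obj (G.obj J₁) ≅ ((F.mapHomologicalComplex (.up ℤ)).obj J).homology i :=
    (DerivedCategory.homologyFunctorFactorsh D i).app
      (((F.mapHomotopyCategory (.up ℤ)).obj ((HomotopyCategory.quotient _ _).obj J))) ≪≫
      (HomotopyCategory.homologyFunctorFactors D (.up ℤ) i).app
        ((F.mapHomologicalComplex (.up ℤ)).obj J)
  exact ⟨e₁ ≪≫ e₂⟩

lemma isZero_rightDerived_succ_iff (X : C) (i : ℕ) :
    IsZero ((rightDerived.{w₁, w₂} F (i + 1)).obj X) ↔ E.Vanish i X := by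
  obtain ⟨J, hJ, f, hf, h⟩ := E.exists_quasiIso ((CochainComplex.singleFunctor C 0).obj X) 0
  have hJ' (n : ℤ) : E.Acyclic (J.X n) := by
    obtain ⟨Y, ⟨r⟩⟩ := h n
    exact E.acyclic_of_retract r
  obtain ⟨e⟩ := E.nonempty_rightDerived_iso X J f hJ' (i + 1)
  have hex (n : ℤ) (hn : 0 < n) : J.ExactAt n :=
    (exactAt_iff_of_quasiIsoAt f n).1 (HomologicalComplex.exactAt_single_obj _ _ _ _ hn.ne')
  have e' := cyclesIsoOfQuasiIso f
  rw [e.isZero_iff, ← HomologicalComplex.exactAt_iff_isZero_homology]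
  have := E.vanish_cycles_iff J hJ' hex i 0
  simp only [Nat.cast_zero, zero_add] at this
  push_cast
  rw [← this]
  exact ⟨Vanish.of_retract (Retract.ofIso e'.symm), Vanish.of_retract (Retract.ofIso e')⟩

end

end FunctorialEmbedding

end

/-! ### Vanishing of left derived functors -/

section

variable {C : Type u₁} [Category.{v₁} C] [Abelian C] {D : Type u₂} [Category.{v₂} D] [Abelian D]

instance (F : C ⥤ D) [PreservesFiniteColimits F] : PreservesFiniteLimits F.op :=
  preservesFiniteLimits_op F

instance (F : C ⥤ D) [PreservesFiniteLimits F] : PreservesFiniteColimits F.op :=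
  preservesFiniteColimits_op F

lemma shortExact_op {X Y Z : C} {f : X ⟶ Y} {g : Y ⟶ Z} {w : f ≫ g = 0}
    (h : (ShortComplex.mk f g w).ShortExact) :
    (ShortComplex.mk g.op f.op (by rw [← op_comp, w, op_zero])).ShortExact := h.op

lemma shortExact_unop {X Y Z : Cᵒᵖ} {f : X ⟶ Y} {g : Y ⟶ Z} {w : f ≫ g = 0}
    (h : (ShortComplex.mk f g w).ShortExact) :
    (ShortComplex.mk g.unop f.unop (by rw [← unop_comp, w, unop_zero])).ShortExact := h.unop

namespace FunctorialEmbedding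

section

variable {F : C ⥤ D} [F.Additive] (E : FunctorialEmbedding F) [PreservesFiniteLimits F]

/-- The vanishing of derived functors does not depend on the choice of the embeddings, up to
passing to the double opposite categories. -/
lemma vanish_op_op_iff (E' : FunctorialEmbedding F.op.op) [PreservesFiniteLimits F.op.op]
    (h : ∀ X, E'.Acyclic (op (op (E.T.obj X)))) (i : ℕ) (X : C) :
    E'.Vanish i (op (op X)) ↔ E.Vanish i X := by
  have S (X : C) := shortExact_op (shortExact_op (E.shortExact X))
  induction i generalizing X with
  | zero =>
    refine (firstVanish_iff_epi (S X) (h X 0)).trans ?_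
    change Epi (F.map (E.π.app X)).op.op ↔ Epi (F.map (E.π.app X))
    exact ⟨fun h ↦ inferInstanceAs (Epi (F.map (E.π.app X)).op.op.unop.unop),
      fun h ↦ inferInstance⟩
  | succ i hi => exact (vanish_succ_X₁_iff (S X) (h X) i).trans (hi (E.coker.obj X))

end

variable {F : C ⥤ D} [F.Additive] (E : FunctorialEmbedding F.op)

/-- The vanishing of the `(i + 1)`-th left derived functor of `F` on the object `X`. -/
def CoVanish (i : ℕ) (X : C) : Prop := E.Vanish i (op X)

/-- The vanishing of all the higher left derived functors of `F`. -/
def CoAcyclic : ObjectProperty C := fun X ↦ E.Acyclic (op X)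

variable {E} [PreservesFiniteColimits F] {X Y Z : C} {f : X ⟶ Y} {g : Y ⟶ Z} {w : f ≫ g = 0}

lemma CoVanish.of_retract {i : ℕ} (r : Retract X Y) (h : E.CoVanish i Y) : E.CoVanish i X :=
  Vanish.of_retract (F := F.op) r.op h

lemma CoAcyclic.of_retract (r : Retract X Y) (h : E.CoAcyclic Y) : E.CoAcyclic X :=
  fun i ↦ CoVanish.of_retract r (h i)

variable (hS : (ShortComplex.mk f g w).ShortExact)

include hS

lemma CoVanish.mono_map (h : E.CoVanish 0 Z) : Mono (F.map f) := by
  have : Epi (F.map f).op := FirstVanish.epi_map_g (shortExact_op hS) h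
  exact inferInstanceAs (Mono (F.map f).op.unop)

lemma coVanish_zero_iff_mono (h : E.CoVanish 0 Y) : E.CoVanish 0 Z ↔ Mono (F.map f) := by
  refine ⟨CoVanish.mono_map hS, fun h' ↦ ?_⟩
  exact (firstVanish_iff_epi (shortExact_op hS) h).2 (inferInstanceAs (Epi (F.map f).op))

lemma CoVanish.X₂ {i : ℕ} (h₁ : E.CoVanish i X) (h₃ : E.CoVanish i Z) : E.CoVanish i Y :=
  Vanish.X₂ (shortExact_op hS) h₃ h₁

lemma CoVanish.X₁ {i : ℕ} (h₂ : E.CoVanish i Y) (h₃ : E.CoVanish (i + 1) Z) : E.CoVanish i X :=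
  Vanish.X₃ (shortExact_op hS) h₂ h₃

lemma coVanish_succ_iff (h : E.CoAcyclic Y) (i : ℕ) : E.CoVanish (i + 1) Z ↔ E.CoVanish i X :=
  vanish_succ_X₁_iff (shortExact_op hS) h i

lemma CoAcyclic.X₂ (h₁ : E.CoAcyclic X) (h₃ : E.CoAcyclic Z) : E.CoAcyclic Y :=
  fun i ↦ CoVanish.X₂ hS (h₁ i) (h₃ i)

lemma CoAcyclic.X₁ (h₂ : E.CoAcyclic Y) (h₃ : E.CoAcyclic Z) : E.CoAcyclic X :=
  fun i ↦ CoVanish.X₁ hS (h₂ i) (h₃ (i + 1))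

lemma CoAcyclic.shortExact_map (h : E.CoAcyclic Z) :
    (ShortComplex.mk (F.map f) (F.map g) (map_comp_eq_zero F w)).ShortExact :=
  shortExact_unop (Acyclic.shortExact_map (shortExact_op hS) h)

lemma coAcyclic_X₃_of_mono (h₁ : E.CoAcyclic X) (h₂ : E.CoAcyclic Y) (h : Mono (F.map f)) :
    E.CoAcyclic Z
  | 0 => (coVanish_zero_iff_mono hS (h₂ 0)).2 h
  | i + 1 => (coVanish_succ_iff hS h₂ i).2 (h₁ i)

end FunctorialEmbedding

end

/-! ### Nakayama functors and their duals -/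

section

variable {A : Type u} [Category.{v} A] [Abelian A]

namespace NakayamaFunctor

variable {P : A ⥤ A} (N : NakayamaFunctor P)

instance : PreservesFiniteLimits N.νR :=
  have := N.adj.rightAdjoint_preservesLimits
  inferInstance

instance : PreservesFiniteColimits N.ν :=
  have := N.adj.leftAdjoint_preservesColimits
  inferInstance

instance : IsIso (Functor.whiskerLeft P N.adj.unit) := by
  have (X : A) : IsIso ((Functor.whiskerLeft P N.adj.unit).app X) := N.isIso_unit X
  exact NatIso.isIso_of_isIso_app _

/-- The functor `P` is determined by `I`. -/
noncomputable def isoP : P ≅ N.I ⋙ N.νR :=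
  asIso (Functor.whiskerLeft P N.adj.unit)

include N in
lemma preservesFiniteColimits_P : PreservesFiniteColimits P :=
  have := N.adjI.leftAdjoint_preservesColimits
  inferInstance

lemma preservesFiniteLimits_I : PreservesFiniteLimits N.I :=
  have := N.adjI.rightAdjoint_preservesLimits
  inferInstance

lemma preservesFiniteColimits_I : PreservesFiniteColimits N.I :=
  have := N.preservesFiniteColimits_P
  comp_preservesFiniteColimits _ _

include N in
-- `I` is left exact as a right adjoint, and `P ≅ ν⁻I` is a composite of left exact functors. Right
-- exactness of `I = νP` is dual.
lemma preservesFiniteLimits_P : PreservesFiniteLimits P := by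
  have := N.preservesFiniteLimits_I
  exact preservesFiniteLimits_of_natIso N.isoP.symm

include N in
lemma additive_P : P.Additive := by
  have := N.adjI.leftAdjoint_preservesColimits
  have := preservesBinaryBiproducts_of_preservesBinaryCoproducts P
  exact Functor.additive_of_preservesBinaryBiproducts P

lemma additive_I : N.I.Additive := by
  have := N.additive_P
  infer_instance

lemma isIso_counit_I (X : A) : IsIso (N.adj.counit.app (N.I.obj X)) := by
  have := N.isIso_unit X
  have h := IsIso.eq_inv_of_hom_inv_id (N.adj.left_triangle_components (P.obj X))
  have : IsIso (inv (N.ν.map (N.adj.unit.app (P.obj X)))) := inferInstance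
  rw [← h] at this
  exact this

section

variable (hP : IsGenerating P)

include hP

/-- Every map `P(Y) ⟶ X`, in particular an epimorphism, factors through the counit. -/
lemma epi_counit (X : A) : Epi (N.adjI.counit.app X) := by
  obtain ⟨Y, f, hf⟩ := hP X
  have h : P.map (N.adjI.homEquiv _ _ f) ≫ N.adjI.counit.app X = f := by
    exact (N.adjI.homEquiv_counit _ _ _).symm.trans (Equiv.symm_apply_apply _ _)
  rw [← h] at hf
  exact epi_of_epi (P.map (N.adjI.homEquiv _ _ f)) _

include N in
lemma isZero_of_isZero_P (X : A) (h : IsZero (P.obj X)) : IsZero X := by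
  have := N.epi_counit hP X
  have := N.additive_P
  exact IsZero.of_epi (N.adjI.counit.app X) (P.map_isZero (N.ν.map_isZero h))

/-- `P` sends the unit to a split monomorphism, so the exact functor `P` kills its kernel; and `P`
detects zero objects. -/
lemma mono_unit (X : A) : Mono (N.adjI.unit.app X) := by
  have := N.preservesFiniteLimits_P
  have := N.additive_P
  apply Preadditive.mono_of_kernel_zero
  have h : P.map (kernel.ι (N.adjI.unit.app X)) = 0 := by
    have h₁ := N.adjI.left_triangle_components X
    have h₂ : P.map (kernel.ι (N.adjI.unit.app X)) ≫ P.map (N.adjI.unit.app X) = 0 :=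
      map_comp_eq_zero P (kernel.condition _)
    have h₃ := h₂ =≫ N.adjI.counit.app (P.obj X)
    rw [Category.assoc, h₁, zero_comp] at h₃
    exact (Category.comp_id _).symm.trans h₃
  have h' : IsZero (kernel (N.adjI.unit.app X)) := by
    apply N.isZero_of_isZero_P hP
    rw [IsZero.iff_id_eq_zero, ← cancel_mono (P.map (kernel.ι (N.adjI.unit.app X))), h]
    simp
  exact h'.eq_of_src _ _

/-- Every object embeds functorially into an `I`-injective object. -/
def rightEmbedding : FunctorialEmbedding N.νR where
  T := P ⋙ N.I
  η := N.adjI.unit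
  additive := by
    have := N.additive_P
    have := N.additive_I
    infer_instance
  mono_η := N.mono_unit hP
  shortExact_map S hS := by
    have := N.preservesFiniteLimits_P
    have := N.preservesFiniteColimits_P
    have := N.preservesFiniteLimits_I
    have := N.preservesFiniteColimits_I
    have := N.additive_P
    exact hS.map_of_exact (P ⋙ N.I)
  -- `ν⁻IP ≅ PP`, and `P` preserves epimorphisms.
  epi_map {X Y} f _ := by
    have := N.preservesFiniteColimits_P
    have h : N.isoP.hom.app (P.obj X) ≫ N.νR.map ((P ⋙ N.I).map f) =
        P.map (P.map f) ≫ N.isoP.hom.app (P.obj Y) := (N.isoP.hom.naturality _).symm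
    have : Epi (N.isoP.hom.app (P.obj X) ≫ N.νR.map ((P ⋙ N.I).map f)) := by
      rw [h]; infer_instance
    exact epi_of_epi (N.isoP.hom.app (P.obj X)) _
  isSplitMono_η X :=
    ⟨⟨{ retraction := N.I.map (N.adjI.counit.app (P.obj X))
        id := N.adjI.right_triangle_components (P.obj X) }⟩⟩

end

/-- The dual Nakayama functor, on the opposite category. -/
noncomputable def dual : NakayamaFunctor N.I.op where
  ν := N.νR.op
  νR := N.ν.op
  adj := N.adj.op
  -- The right adjoint must be `(ν⁻I)ᵒᵖ`, whereas dualizing `P ⊣ I` gives `Pᵒᵖ`; `isoP` identifies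
  -- them.
  adjI := N.adjI.op.ofNatIsoRight (NatIso.op N.isoP).symm
  isIso_unit X := by
    have := N.isIso_counit_I X.unop
    exact inferInstanceAs (IsIso (N.adj.counit.app (N.I.obj X.unop)).op)

lemma isGenerating_dual (hP : IsGenerating P) : IsGenerating N.I.op := by
  intro X
  have := N.mono_unit hP X.unop
  exact ⟨op (P.obj X.unop), (N.adjI.unit.app X.unop).op, inferInstance⟩

section

variable (hP : IsGenerating P)

/-- Every object is functorially a quotient of a `P`-projective object; this is stated in the
opposite category. -/
noncomputable def leftEmbedding : FunctorialEmbedding N.ν.op :=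
  N.dual.rightEmbedding (N.isGenerating_dual hP)

variable {X : A}

lemma acyclic_of_isInjective (hX : IsSummandOfImage N.I X) : (N.rightEmbedding hP).Acyclic X := by
  obtain ⟨Y, ⟨r⟩⟩ := hX
  exact FunctorialEmbedding.acyclic_of_retract (Y := N.I.obj Y) _
    (r.trans ⟨N.adjI.unit.app (N.I.obj Y), N.I.map (N.adjI.counit.app Y),
      N.adjI.right_triangle_components Y⟩)

/-- The functor `P` as the functor `I` of the dual Nakayama functor. -/
noncomputable def isoDualI : P.op ≅ N.dual.I := NatIso.op N.isoP.symm

/-- The functor `I` as the functor `I` of the double dual Nakayama functor. -/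
noncomputable def isoDualDualI (X : A) : op (op (N.I.obj X)) ≅ N.dual.dual.I.obj (op (op X)) :=
  have := N.isIso_counit_I X
  (asIso (N.adj.counit.app (N.I.obj X)).op.op).symm

lemma coAcyclic_of_isProjective (hX : IsSummandOfImage P X) :
    (N.leftEmbedding hP).CoAcyclic X := by
  obtain ⟨Y, ⟨r⟩⟩ := hX
  exact N.dual.acyclic_of_isInjective (N.isGenerating_dual hP)
    ⟨op Y, ⟨r.op.trans (Retract.ofIso (N.isoDualI.app (op Y)))⟩⟩

/-- The embedding of the double dual is not literally the original one, but its acyclic objects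
include the `I`-injectives, and that is enough to compare vanishing. -/
lemma coVanish_dual_iff (i : ℕ) :
    (N.dual.leftEmbedding (N.isGenerating_dual hP)).CoVanish i (op X) ↔
      (N.rightEmbedding hP).Vanish i X :=
  (N.rightEmbedding hP).vanish_op_op_iff
    (N.dual.dual.rightEmbedding (N.dual.isGenerating_dual (N.isGenerating_dual hP)))
    (fun X ↦ N.dual.dual.acyclic_of_isInjective _
      ⟨op (op (P.obj X)), ⟨Retract.ofIso (N.isoDualDualI (P.obj X))⟩⟩) i X

lemma isIso_unit_of_isProjective (hX : IsSummandOfImage P X) : IsIso (N.adj.unit.app X) := by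
  obtain ⟨Y, ⟨r⟩⟩ := hX
  have := N.isIso_unit Y
  have h₁ : r.i ≫ N.adj.unit.app (P.obj Y) = N.adj.unit.app X ≫ N.νR.map (N.ν.map r.i) :=
    N.adj.unit.naturality r.i
  have h₂ : r.r ≫ N.adj.unit.app X = N.adj.unit.app (P.obj Y) ≫ N.νR.map (N.ν.map r.r) :=
    N.adj.unit.naturality r.r
  refine ⟨N.νR.map (N.ν.map r.i) ≫ inv (N.adj.unit.app (P.obj Y)) ≫ r.r, ?_, ?_⟩
  · rw [← reassoc_of% h₁, IsIso.hom_inv_id_assoc, r.retract]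
    rfl
  · rw [Category.assoc, Category.assoc, h₂, IsIso.inv_hom_id_assoc, ← N.νR.map_comp,
      ← N.ν.map_comp, r.retract]
    simp

lemma isIso_counit_of_isInjective (hX : IsSummandOfImage N.I X) :
    IsIso (N.adj.counit.app X) := by
  obtain ⟨Y, ⟨r⟩⟩ := hX
  have := N.dual.isIso_unit_of_isProjective (X := op X) ⟨op Y, ⟨r.op⟩⟩
  exact inferInstanceAs (IsIso (N.dual.adj.unit.app (op X)).unop)

lemma isInjective_ν (hX : IsSummandOfImage P X) : IsSummandOfImage N.I (N.ν.obj X) := by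
  obtain ⟨Y, ⟨r⟩⟩ := hX
  exact ⟨Y, ⟨r.map N.ν⟩⟩

lemma isProjective_νR (hX : IsSummandOfImage N.I X) : IsSummandOfImage P (N.νR.obj X) := by
  obtain ⟨Y, ⟨r⟩⟩ := hX
  exact ⟨Y, ⟨(r.map N.νR).trans (Retract.ofIso (N.isoP.symm.app Y))⟩⟩

end

end NakayamaFunctor

end

/-! ### Complete resolutions as families of short exact sequences -/

section

/-- Splices one-step extensions into a two-sided sequence: predecessors fill the positive indices
and successors the negative ones, since the differentials lower degrees. -/
lemma exists_int_seq {α : Type*} {p : α → Prop} {R : α → α → Prop}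
    (h₁ : ∀ x, p x → ∃ y, p y ∧ R x y) (h₂ : ∀ x, p x → ∃ y, p y ∧ R y x) {x : α} (hx : p x) :
    ∃ Z : ℤ → α, Z 0 = x ∧ ∀ n m, m + 1 = n → R (Z n) (Z m) := by
  have h₁' (x : {x // p x}) : ∃ y : {x // p x}, R x.1 y.1 := by
    obtain ⟨y, hy, h⟩ := h₁ x.1 x.2
    exact ⟨⟨y, hy⟩, h⟩
  have h₂' (x : {x // p x}) : ∃ y : {x // p x}, R y.1 x.1 := by
    obtain ⟨y, hy, h⟩ := h₂ x.1 x.2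
    exact ⟨⟨y, hy⟩, h⟩
  choose f hf using h₁'
  choose g hg using h₂'
  let Z : ℤ → {x // p x}
    | Int.ofNat n => g^[n] ⟨x, hx⟩
    | Int.negSucc n => f^[n + 1] ⟨x, hx⟩
  refine ⟨fun n ↦ (Z n).1, rfl, ?_⟩
  rintro _ (m | m) rfl
  · have : Z (Int.ofNat m + 1) = g (Z (Int.ofNat m)) := Function.iterate_succ_apply' g m _
    change R (Z (Int.ofNat m + 1)).1 _
    rw [this]
    exact hg _
  · cases m with
    | zero => exact hf ⟨x, hx⟩
    | succ m =>
      have h₁ : Z (Int.negSucc (m + 1) + 1) = f^[m + 1] ⟨x, hx⟩ := rfl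
      have h₂ : Z (Int.negSucc (m + 1)) = f (f^[m + 1] ⟨x, hx⟩) :=
        Function.iterate_succ_apply' f (m + 1) _
      change R (Z (Int.negSucc (m + 1) + 1)).1 (Z (Int.negSucc (m + 1))).1
      rw [h₁, h₂]
      exact hf _

variable {C : Type u₁} [Category.{v₁} C] [Abelian C] {D : Type u₂} [Category.{v₂} D] [Abelian D]
  (F : C ⥤ D) [F.Additive] (𝒬 : ObjectProperty C)

/-- There is a short exact sequence from `X` to `Z` with middle term in `𝒬` which stays exact
under `F`. -/
def IsLinked (X Z : C) : Prop :=
  ∃ (Y : C) (f : X ⟶ Y) (g : Y ⟶ Z) (w : f ≫ g = 0), 𝒬 Y ∧ (ShortComplex.mk f g w).ShortExact ∧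
    (ShortComplex.mk (F.map f) (F.map g) (map_comp_eq_zero F w)).ShortExact

/-- The object `G` is a cycle object in an exact complex of objects in `𝒬` which stays exact
under `F`. -/
def IsCompleteCycle : ObjectProperty C :=
  fun G ↦ ∃ Q : ChainComplex C ℤ, (∀ i, 𝒬 (Q.X i)) ∧ Q.Acyclic ∧
    ((F.mapHomologicalComplex _).obj Q).Acyclic ∧ Nonempty (kernel (Q.d 0 (-1)) ≅ G)

variable {F 𝒬}

lemma shortExact_map_cycles_of_leftExact [PreservesFiniteLimits F] {Q : ChainComplex C ℤ}
    (_ : Q.Acyclic) (h' : ((F.mapHomologicalComplex _).obj Q).Acyclic) {n m : ℤ} (hnm : m + 1 = n) :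
    (ShortComplex.mk _ _ (map_comp_eq_zero F (iCycles_toCycles Q n m))).ShortExact where
  exact := exact_map_of_leftExact F (exact_iCycles_toCycles Q hnm)
  mono_f := inferInstanceAs (Mono (F.map (Q.iCycles n)))
  epi_g := (exactAt_map_iff_epi (c := ComplexShape.down ℤ) (k := m - 1) Q F hnm (by simp)).1 (h' m)

/-- For a right exact functor only injectivity of `F(Zₙ) ⟶ F(Qₙ)` is at stake. As `F(Qₙ₊₁)` covers
`F(Zₙ)`, it follows from exactness of `F(Q)` in degree `n + 1`. -/
lemma shortExact_map_cycles_of_rightExact [PreservesFiniteColimits F] {Q : ChainComplex C ℤ}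
    (h : Q.Acyclic) (h' : ((F.mapHomologicalComplex _).obj Q).Acyclic) {n m : ℤ} (hnm : m + 1 = n) :
    (ShortComplex.mk _ _ (map_comp_eq_zero F (iCycles_toCycles Q n m))).ShortExact where
  exact :=
    have : Epi (Q.toCycles n m) := (exactAt_iff_epi_toCycles Q hnm).1 (h m)
    ShortComplex.Exact.map_of_epi_of_preservesCokernel (exact_iCycles_toCycles Q hnm) F
      inferInstance inferInstance
  mono_f := by
    have : Epi (Q.toCycles (n + 1) n) := (exactAt_iff_epi_toCycles Q (by simp)).1 (h n)
    have h₁ := h' (n + 1)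
    rw [HomologicalComplex.exactAt_iff' _ (n + 2) (n + 1) n
      ((ComplexShape.down ℤ).prev_eq' (by simp; ring)) ((ComplexShape.down ℤ).next_eq' (by simp))]
      at h₁
    have h₂ : (ShortComplex.mk (F.map (Q.d (n + 2) (n + 1))) (F.map (Q.d (n + 1) n))
      (map_comp_eq_zero F (Q.d_comp_d _ _ _))).Exact := h₁
    apply Preadditive.mono_of_cancel_zero
    intro A (z : A ⟶ F.obj (Q.cycles n)) (hz : z ≫ F.map (Q.iCycles n) = 0)
    obtain ⟨A₁, π₁, _, y, hy⟩ :=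
      surjective_up_to_refinements_of_epi (F.map (Q.toCycles (n + 1) n)) z
    obtain ⟨A₂, π₂, _, x, hx⟩ := exists_lift_of_exact h₂ y (by
      rw [← Q.toCycles_i, F.map_comp, ← reassoc_of% hy, hz, comp_zero])
    rw [← cancel_epi π₁, ← cancel_epi π₂, hy, reassoc_of% hx, ← F.map_comp, Q.d_toCycles]
    simp
  epi_g :=
    have : Epi (Q.toCycles n m) := (exactAt_iff_epi_toCycles Q hnm).1 (h m)
    inferInstanceAs (Epi (F.map (Q.toCycles n m)))

lemma isCompleteCycle_iff
    (hF : ∀ (Q : ChainComplex C ℤ), Q.Acyclic → ((F.mapHomologicalComplex _).obj Q).Acyclic →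
      ∀ {n m : ℤ}, m + 1 = n →
        (ShortComplex.mk _ _ (map_comp_eq_zero F (iCycles_toCycles Q n m))).ShortExact) (G : C) :
    IsCompleteCycle F 𝒬 G ↔ ∃ Z : ℤ → C, Nonempty (Z 0 ≅ G) ∧
      ∀ n m, m + 1 = n → IsLinked F 𝒬 (Z n) (Z m) := by
  constructor
  · rintro ⟨Q, hQ, h, h', ⟨e⟩⟩
    refine ⟨fun n ↦ Q.cycles n, ⟨?_ ≪≫ e⟩, fun n m hnm ↦
      ⟨Q.X n, Q.iCycles n, Q.toCycles n m, iCycles_toCycles Q n m, hQ n,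
        shortExact_cycles Q hnm (h m), hF Q h h' hnm⟩⟩
    exact (Q.cyclesIsKernel 0 (-1) ((ComplexShape.down ℤ).next_eq' (by simp))).conePointUniqueUpToIso
      (limit.isLimit _)
  · rintro ⟨Z, ⟨e⟩, h⟩
    -- Writing the index as `n + 1 - 1` makes the target of `g (n + 1)` syntactically the source of
    -- `f n`, so the two compose without transport.
    have h' (n : ℤ) : IsLinked F 𝒬 (Z (n + 1 - 1)) (Z (n - 1)) := h _ _ (by ring)
    choose Y f g w hY hS hFS using h'
    have (n : ℤ) : Mono (f n) := (hS n).mono_f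
    have (n : ℤ) : Epi (g n) := (hS n).epi_g
    have (n : ℤ) : Mono (F.map (f n)) := (hFS n).mono_f
    have (n : ℤ) : Epi (F.map (g n)) := (hFS n).epi_g
    let d (n : ℤ) : Y (n + 1) ⟶ Y n := g (n + 1) ≫ f n
    let Q : ChainComplex C ℤ := ChainComplex.of Y d (fun n ↦ by
      simp only [d, Category.assoc]
      rw [reassoc_of% (w (n + 1)), zero_comp, comp_zero])
    have hd (n : ℤ) : Q.d (n + 1) n = d n := ChainComplex.of_d _ _ _
    have prev (n : ℤ) : (ComplexShape.down ℤ).prev n = n + 1 :=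
      (ComplexShape.down ℤ).prev_eq' (by simp)
    have next (n : ℤ) : (ComplexShape.down ℤ).next (n + 1) = n :=
      (ComplexShape.down ℤ).next_eq' (by simp)
    have key : ∀ n : ℤ, Nonempty (kernel (Q.d (n + 1) n) ≅ Z (n + 1 + 1 - 1)) := fun n ↦
      ⟨kernelIsoOfEq (hd n) ≪≫ kernelCompMono (g (n + 1)) (f n) ≪≫
        (limit.isLimit _).conePointUniqueUpToIso (hS (n + 1)).fIsKernel⟩
    refine ⟨Q, hY, fun i ↦ ?_, fun i ↦ ?_, ?_⟩
    · obtain ⟨n, rfl⟩ : ∃ n, n + 1 = i := ⟨i - 1, by ring⟩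
      rw [Q.exactAt_iff' (n + 1 + 1) (n + 1) n (prev _) (next _)]
      exact exact_of_factorization (f := Q.d (n + 1 + 1) (n + 1)) (g := Q.d (n + 1) n)
        (Q.d_comp_d _ _ _) (g (n + 1 + 1)) (f (n + 1)) (g (n + 1)) (f n) (hd _).symm (hd _).symm
        (hS (n + 1)).exact
    · obtain ⟨n, rfl⟩ : ∃ n, n + 1 = i := ⟨i - 1, by ring⟩
      rw [HomologicalComplex.exactAt_iff' _ (n + 1 + 1) (n + 1) n (prev _) (next _)]
      exact exact_of_factorization (f := F.map (Q.d (n + 1 + 1) (n + 1)))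
        (g := F.map (Q.d (n + 1) n)) (map_comp_eq_zero F (Q.d_comp_d _ _ _))
        (F.map (g (n + 1 + 1))) (F.map (f (n + 1))) (F.map (g (n + 1))) (F.map (f n))
        ((F.map_comp _ _).symm.trans (congrArg F.map (hd _).symm))
        ((F.map_comp _ _).symm.trans (congrArg F.map (hd _).symm)) (hFS (n + 1)).exact
    · obtain ⟨e'⟩ := key (-1)
      exact ⟨e' ≪≫ e⟩

end

/-! ### Gorenstein projective objects and acyclicity -/

section

variable {A : Type u} [Category.{v} A] [Abelian A]

namespace NakayamaFunctor

open FunctorialEmbedding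

variable {P : A ⥤ A} (N : NakayamaFunctor P)

/-- The unit of the adjunction `ν ⊣ ν⁻`. -/
def unitApp (X : A) : X ⟶ N.νR.obj (N.ν.obj X) := N.adj.unit.app X

/-- The counit of the adjunction `ν ⊣ ν⁻`. -/
def counitApp (X : A) : N.ν.obj (N.νR.obj X) ⟶ X := N.adj.counit.app X

lemma unitApp_naturality {X Y : A} (f : X ⟶ Y) :
    f ≫ N.unitApp Y = N.unitApp X ≫ N.νR.map (N.ν.map f) :=
  N.adj.unit.naturality f

lemma counitApp_naturality {X Y : A} (f : X ⟶ Y) :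
    N.ν.map (N.νR.map f) ≫ N.counitApp Y = N.counitApp X ≫ f :=
  N.adj.counit.naturality f

@[simp]
lemma map_unitApp_counitApp (X : A) : N.ν.map (N.unitApp X) ≫ N.counitApp (N.ν.obj X) = 𝟙 _ :=
  N.adj.left_triangle_components X

@[simp]
lemma unitApp_map_counitApp (X : A) : N.unitApp (N.νR.obj X) ≫ N.νR.map (N.counitApp X) = 𝟙 _ :=
  N.adj.right_triangle_components X

section

variable {X Y Z : A} {f : X ⟶ Y} {g : Y ⟶ Z} {w : f ≫ g = 0}

lemma mono_unitApp_of_mono [Mono f] [Mono (N.unitApp Y)] : Mono (N.unitApp X) := by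
  have : Mono (N.unitApp X ≫ N.νR.map (N.ν.map f)) := by
    rw [← N.unitApp_naturality]; exact mono_comp _ _
  exact mono_of_mono _ (N.νR.map (N.ν.map f))

/-- A four lemma argument: `ν⁻` is left exact, so an element of `ν⁻νX` lifts to `Y`, and its image
in `Z` vanishes since the unit of `Z` is mono. -/
lemma isIso_unitApp_X₁ (hS : (ShortComplex.mk f g w).ShortExact)
    (hS' : (ShortComplex.mk (N.ν.map f) (N.ν.map g) (map_comp_eq_zero N.ν w)).ShortExact)
    (hY : IsIso (N.unitApp Y)) (hZ : Mono (N.unitApp Z)) :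
    IsIso (N.unitApp X) := by
  have : Mono f := hS.mono_f
  have : Mono (N.ν.map f) := hS'.mono_f
  have : Mono (N.unitApp X) := N.mono_unitApp_of_mono (f := f)
  have : Epi (N.unitApp X) := by
    rw [epi_iff_surjective_up_to_refinements]
    intro T (z : T ⟶ N.νR.obj (N.ν.obj X))
    obtain ⟨T', π, hπ, x, hx⟩ := exists_lift_of_exact hS.exact
      (z ≫ N.νR.map (N.ν.map f) ≫ inv (N.unitApp Y)) (by
        rw [← cancel_mono (N.unitApp Z), Category.assoc, N.unitApp_naturality, Category.assoc,
          Category.assoc, IsIso.inv_hom_id_assoc, ← N.νR.map_comp, ← N.ν.map_comp, w]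
        simp)
    refine ⟨T', π, hπ, x, ?_⟩
    rw [← cancel_mono (N.νR.map (N.ν.map f))]
    have h := hx =≫ N.unitApp Y
    rw [Category.assoc, Category.assoc, Category.assoc, IsIso.inv_hom_id, Category.assoc,
      N.unitApp_naturality] at h
    simpa using h
  exact isIso_of_mono_of_epi _

lemma epi_unitApp_of_epi [Epi (N.unitApp Y)] [Epi (N.νR.map (N.ν.map g))] :
    Epi (N.unitApp Z) := by
  have : Epi (g ≫ N.unitApp Z) := by
    rw [N.unitApp_naturality]; exact epi_comp _ _
  exact epi_of_epi g _

lemma isIso_unitApp_X₃ (hS : (ShortComplex.mk f g w).ShortExact)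
    (hS' : (ShortComplex.mk (N.νR.map (N.ν.map f)) (N.νR.map (N.ν.map g))
      (map_comp_eq_zero N.νR (map_comp_eq_zero N.ν w))).ShortExact)
    (hX : Epi (N.unitApp X)) (hY : IsIso (N.unitApp Y)) :
    IsIso (N.unitApp Z) := by
  have : Epi g := hS.epi_g
  have : Epi (N.νR.map (N.ν.map g)) := hS'.epi_g
  have : Epi (N.unitApp Z) := N.epi_unitApp_of_epi (g := g)
  have : Mono (N.unitApp Z) := by
    apply Preadditive.mono_of_cancel_zero
    intro T (z : T ⟶ Z) hz
    obtain ⟨T₁, π₁, _, y, hy⟩ := surjective_up_to_refinements_of_epi g z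
    obtain ⟨T₂, π₂, _, x, hx⟩ := exists_lift_of_exact hS'.exact (y ≫ N.unitApp Y) (by
      rw [Category.assoc, ← N.unitApp_naturality, ← reassoc_of% hy, hz, comp_zero])
    obtain ⟨T₃, π₃, _, t, ht⟩ := surjective_up_to_refinements_of_epi (N.unitApp X) x
    have h : π₃ ≫ π₂ ≫ y = t ≫ f := by
      rw [← cancel_mono (N.unitApp Y), Category.assoc, Category.assoc, hx, Category.assoc,
        N.unitApp_naturality, reassoc_of% ht]
    rw [← cancel_epi π₁, ← cancel_epi π₂, ← cancel_epi π₃, hy, reassoc_of% h, w]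
    simp
  exact isIso_of_mono_of_epi _

lemma isIso_counitApp_X₃ (hS : (ShortComplex.mk f g w).ShortExact)
    {Y' Z' : A} {f' : X ⟶ Y'} {g' : Y' ⟶ Z'} {w' : f' ≫ g' = 0}
    (hS' : (ShortComplex.mk f' g' w').ShortExact) (a : Y ⟶ Y') (b : Z ⟶ Z') [IsIso a]
    (h₁ : f ≫ a = f') (h₂ : g ≫ b = a ≫ g') : IsIso b := by
  have : Epi g := hS.epi_g
  have : Epi g' := hS'.epi_g
  obtain ⟨b', hb'⟩ := CokernelCofork.IsColimit.desc' hS'.gIsCokernel (inv a ≫ g) (by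
    change f' ≫ inv a ≫ g = 0
    rw [← h₁, Category.assoc, IsIso.hom_inv_id_assoc, w])
  have hb : g' ≫ b' = inv a ≫ g := hb'
  refine ⟨b', ?_, ?_⟩
  · rw [← cancel_epi g, reassoc_of% h₂, hb, IsIso.hom_inv_id_assoc, Category.comp_id]
  · rw [← cancel_epi g', reassoc_of% hb, h₂, IsIso.inv_hom_id_assoc, Category.comp_id]

end

variable (hP : IsGenerating P)

include N hP in
lemma exists_cover (X : A) : ∃ (K Q : A) (f : K ⟶ Q) (g : Q ⟶ X) (w : f ≫ g = 0),
    IsSummandOfImage P Q ∧ (ShortComplex.mk f g w).ShortExact := by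
  have := N.epi_counit hP X
  let p : P.obj (N.I.obj X) ⟶ X := N.adjI.counit.app X
  have : Epi p := this
  exact ⟨_, _, kernel.ι p, p, kernel.condition _, ⟨_, ⟨Retract.refl _⟩⟩,
    { exact := ShortComplex.exact_of_f_is_kernel _ (kernelIsKernel _) }⟩

/-- A characterization of Gorenstein projective objects in terms of the vanishing of derived
functors, see `isGorensteinProjective_iff`. -/
structure IsBiacyclic (G : A) : Prop where
  coAcyclic : (N.leftEmbedding hP).CoAcyclic G
  acyclic : (N.rightEmbedding hP).Acyclic (N.ν.obj G)
  isIso_unit : IsIso (N.unitApp G)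

variable {N hP}

section

variable {X Y Z : A} {f : X ⟶ Y} {g : Y ⟶ Z} {w : f ≫ g = 0}

/-- For `R¹ν⁻(νX) = 0` the map `ν⁻νY ⟶ ν⁻νZ` must be epi; the units identify it with `Y ⟶ Z`. -/
lemma IsBiacyclic.X₁ (hS : (ShortComplex.mk f g w).ShortExact) (hY : N.IsBiacyclic hP Y)
    (hZ : N.IsBiacyclic hP Z) : N.IsBiacyclic hP X := by
  have hS' := CoAcyclic.shortExact_map hS hZ.coAcyclic
  have := hY.isIso_unit
  have := hZ.isIso_unit
  refine ⟨.X₁ hS hY.coAcyclic hZ.coAcyclic, acyclic_X₁_of_epi hS' hY.acyclic hZ.acyclic ?_,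
    N.isIso_unitApp_X₁ hS hS' hY.isIso_unit inferInstance⟩
  have : Epi g := hS.epi_g
  have : Epi (N.unitApp Y ≫ N.νR.map (N.ν.map g)) := by
    rw [← N.unitApp_naturality]; exact epi_comp _ _
  exact epi_of_epi (N.unitApp Y) _

lemma IsBiacyclic.X₃ (hS : (ShortComplex.mk f g w).ShortExact) (hX : N.IsBiacyclic hP X)
    (hY : N.IsBiacyclic hP Y) (hZ : (N.leftEmbedding hP).CoAcyclic Z) :
    N.IsBiacyclic hP Z := by
  have hS' := CoAcyclic.shortExact_map hS hZ
  have := hX.isIso_unit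
  exact ⟨hZ, .X₃ hS' hX.acyclic hY.acyclic,
    N.isIso_unitApp_X₃ hS (Acyclic.shortExact_map hS' hX.acyclic) inferInstance hY.isIso_unit⟩

end

lemma IsBiacyclic.of_iso {X Y : A} (e : X ≅ Y) (h : N.IsBiacyclic hP X) :
    N.IsBiacyclic hP Y := by
  refine ⟨CoAcyclic.of_retract (Retract.ofIso e.symm) h.coAcyclic,
    Acyclic.of_retract (Retract.ofIso (N.ν.mapIso e.symm)) h.acyclic, ?_⟩
  have := h.isIso_unit
  exact (NatTrans.isIso_app_iff_of_iso N.adj.unit e).1 this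

variable (N hP)

lemma isBiacyclic_of_isProjective {Q : A} (hQ : IsSummandOfImage P Q) : N.IsBiacyclic hP Q :=
  ⟨N.coAcyclic_of_isProjective hP hQ, N.acyclic_of_isInjective hP (N.isInjective_ν hQ),
    N.isIso_unit_of_isProjective hQ⟩

lemma exists_isLinked_left {G : A} (hG : N.IsBiacyclic hP G) :
    ∃ G', N.IsBiacyclic hP G' ∧ IsLinked N.ν (IsSummandOfImage P) G' G := by
  obtain ⟨K, Q, f, g, w, hQ, hS⟩ := N.exists_cover hP G
  exact ⟨K, .X₁ hS (N.isBiacyclic_of_isProjective hP hQ) hG, Q, f, g, w, hQ, hS,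
    CoAcyclic.shortExact_map hS hG.coAcyclic⟩

/-- Embed `νG` in an `I`-injective `J` with cokernel `C`. As `R¹ν⁻(νG) = 0`, applying `ν⁻` gives `G
⟶ ν⁻J ⟶ ν⁻C` short exact with `P`-projective middle term, and `ν⁻C` is the next cycle object. -/
lemma exists_isLinked_right {G : A} (hG : N.IsBiacyclic hP G) :
    ∃ G', N.IsBiacyclic hP G' ∧ IsLinked N.ν (IsSummandOfImage P) G G' := by
  obtain ⟨J, C, i, p, w₀, hJ, S⟩ : ∃ (J C : A) (i : N.ν.obj G ⟶ J) (p : J ⟶ C) (w : i ≫ p = 0),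
      IsSummandOfImage N.I J ∧ (ShortComplex.mk i p w).ShortExact :=
    ⟨_, _, _, _, _, ⟨_, ⟨Retract.refl _⟩⟩, (N.rightEmbedding hP).shortExact (N.ν.obj G)⟩
  have hQ := N.isProjective_νR hJ
  have hcounit : IsIso (N.counitApp J) := N.isIso_counit_of_isInjective hJ
  have hiso := hG.isIso_unit
  have S₁ : (ShortComplex.mk (N.νR.map i) (N.νR.map p) (map_comp_eq_zero N.νR w₀)).ShortExact :=
    Acyclic.shortExact_map S hG.acyclic
  have w : (N.unitApp G ≫ N.νR.map i) ≫ N.νR.map p = 0 := by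
    rw [Category.assoc, map_comp_eq_zero N.νR w₀, comp_zero]
  have hS : (ShortComplex.mk (N.unitApp G ≫ N.νR.map i) (N.νR.map p) w).ShortExact :=
    ShortComplex.shortExact_of_iso (ShortComplex.isoMk (asIso (N.unitApp G)).symm
      (Iso.refl (N.νR.obj J)) (Iso.refl (N.νR.obj C))
      ((IsIso.inv_hom_id_assoc _ _).trans (Category.comp_id _).symm)
      ((Category.id_comp _).trans (Category.comp_id _).symm)) S₁
  have hf : N.ν.map (N.unitApp G ≫ N.νR.map i) ≫ N.counitApp J = i := by
    rw [N.ν.map_comp, Category.assoc, N.counitApp_naturality, ← Category.assoc,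
      map_unitApp_counitApp, Category.id_comp]
  -- Followed by the counit of `J` this map is `i`, which is mono; it yields `L₁ν(ν⁻C) = 0`.
  have hmono : Mono (N.ν.map (N.unitApp G ≫ N.νR.map i)) := by
    have : Mono (N.ν.map (N.unitApp G ≫ N.νR.map i) ≫ N.counitApp J) := by
      rw [hf]; exact S.mono_f
    exact mono_of_mono _ (N.counitApp J)
  have hcoacyclic := coAcyclic_X₃_of_mono hS hG.coAcyclic
    (N.coAcyclic_of_isProjective hP hQ) hmono
  have hS' := CoAcyclic.shortExact_map hS hcoacyclic
  -- `νν⁻C` and `C` are cokernels of maps out of `νG` identified by the counit of `J`; hence the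
  -- unit at `ν⁻C` is an isomorphism too.
  have hcounit' : IsIso (N.counitApp C) :=
    isIso_counitApp_X₃ hS' S (N.counitApp J) _ hf (N.counitApp_naturality p)
  refine ⟨N.νR.obj C, ⟨hcoacyclic,
    Acyclic.X₃ hS' hG.acyclic (N.acyclic_of_isInjective hP (N.isInjective_ν hQ)), ?_⟩,
    _, _, _, w, hQ, hS, hS'⟩
  rw [IsIso.eq_inv_of_inv_hom_id (N.unitApp_map_counitApp C)]
  infer_instance

-- All cycle objects are treated at once: `Lᵢν` shifts to the previous cycle object and `Rⁱν⁻` to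
-- the next one. Every `Zₙ` embeds in a `P`-projective, so all units are mono, and this upgrades
-- them to isomorphisms.
variable {N} in
lemma isBiacyclic_of_isLinked {Z : ℤ → A}
    (h : ∀ n m, m + 1 = n → IsLinked N.ν (IsSummandOfImage P) (Z n) (Z m)) (n : ℤ) :
    N.IsBiacyclic hP (Z n) := by
  have h₁ (i : ℕ) : ∀ m, (N.leftEmbedding hP).CoVanish i (Z m) := by
    induction i with
    | zero =>
      intro m
      obtain ⟨Y, f, g, w, hY, hS, hS'⟩ := h (m + 1) m rfl
      exact (coVanish_zero_iff_mono hS (N.coAcyclic_of_isProjective hP hY 0)).2 hS'.mono_f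
    | succ i hi =>
      intro m
      obtain ⟨Y, f, g, w, hY, hS, hS'⟩ := h (m + 1) m rfl
      exact (coVanish_succ_iff hS (N.coAcyclic_of_isProjective hP hY) i).2 (hi _)
  have h₂ (n : ℤ) : Mono (N.unitApp (Z n)) := by
    obtain ⟨Y, f, g, w, hY, hS, hS'⟩ := h n (n - 1) (by ring)
    have : Mono f := hS.mono_f
    have : IsIso (N.unitApp Y) := N.isIso_unit_of_isProjective hY
    exact N.mono_unitApp_of_mono (f := f)
  have h₃ (n : ℤ) : IsIso (N.unitApp (Z n)) := by
    obtain ⟨Y, f, g, w, hY, hS, hS'⟩ := h n (n - 1) (by ring)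
    exact N.isIso_unitApp_X₁ hS hS' (N.isIso_unit_of_isProjective hY) (h₂ _)
  have h₄ (i : ℕ) : ∀ n, (N.rightEmbedding hP).Vanish i (N.ν.obj (Z n)) := by
    induction i with
    | zero =>
      intro n
      obtain ⟨Y, f, g, w, hY, hS, hS'⟩ := h n (n - 1) (by ring)
      refine (firstVanish_iff_epi hS'
        (N.acyclic_of_isInjective hP (N.isInjective_ν hY) 0)).2 ?_
      have : Epi g := hS.epi_g
      have : Epi (N.unitApp Y ≫ N.νR.map (N.ν.map g)) := by
        rw [← N.unitApp_naturality]; exact epi_comp _ _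
      exact epi_of_epi (N.unitApp Y) _
    | succ i hi =>
      intro n
      obtain ⟨Y, f, g, w, hY, hS, hS'⟩ := h n (n - 1) (by ring)
      exact (vanish_succ_X₁_iff hS' (N.acyclic_of_isInjective hP (N.isInjective_ν hY)) i).2 (hi _)
  exact ⟨fun i ↦ h₁ i n, fun i ↦ h₄ i n, h₃ n⟩

lemma isGorensteinProjective_iff_exists (G : A) : IsGorensteinProjective N G ↔
    ∃ Z : ℤ → A, Nonempty (Z 0 ≅ G) ∧
      ∀ n m, m + 1 = n → IsLinked N.ν (IsSummandOfImage P) (Z n) (Z m) :=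
  isCompleteCycle_iff (F := N.ν)
    (fun _ h h' _ _ hnm ↦ shortExact_map_cycles_of_rightExact h h' hnm) G

lemma isGorensteinInjective_iff_exists (G : A) : IsGorensteinInjective N G ↔
    ∃ Z : ℤ → A, Nonempty (Z 0 ≅ G) ∧
      ∀ n m, m + 1 = n → IsLinked N.νR (IsSummandOfImage N.I) (Z n) (Z m) :=
  isCompleteCycle_iff (F := N.νR)
    (fun _ h h' _ _ hnm ↦ shortExact_map_cycles_of_leftExact h h' hnm) G

lemma isGorensteinProjective_iff (G : A) :
    IsGorensteinProjective N G ↔ N.IsBiacyclic hP G := by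
  rw [isGorensteinProjective_iff_exists]
  constructor
  · rintro ⟨Z, ⟨e⟩, h⟩
    exact (isBiacyclic_of_isLinked hP h 0).of_iso e
  · intro h
    obtain ⟨Z, hZ, h'⟩ := exists_int_seq
      (fun _ h ↦ N.exists_isLinked_right hP h) (fun _ h ↦ N.exists_isLinked_left hP h) h
    exact ⟨Z, ⟨eqToIso hZ⟩, h'⟩

variable {N} in
lemma isLinked_dual_iff {X Z : A} :
    IsLinked N.dual.ν (IsSummandOfImage N.I.op) (op Z) (op X) ↔
      IsLinked N.νR (IsSummandOfImage N.I) X Z := by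
  constructor
  · rintro ⟨Y, f, g, w, ⟨Y', ⟨r⟩⟩, hS, hS'⟩
    exact ⟨Y.unop, g.unop, f.unop, _, ⟨Y'.unop, 
      ⟨⟨r.r.unop, r.i.unop, congrArg Quiver.Hom.unop r.retract⟩⟩⟩,
      shortExact_unop hS, shortExact_unop hS'⟩
  · rintro ⟨Y, f, g, w, ⟨Y', ⟨r⟩⟩, hS, hS'⟩
    exact ⟨op Y, g.op, f.op, _, ⟨op Y', ⟨r.op⟩⟩, shortExact_op hS, shortExact_op hS'⟩

lemma isGorensteinProjective_dual_iff (G : A) :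
    IsGorensteinProjective N.dual (op G) ↔ IsGorensteinInjective N G := by
  rw [isGorensteinProjective_iff_exists, isGorensteinInjective_iff_exists]
  constructor
  · rintro ⟨Z, ⟨e⟩, h⟩
    exact ⟨fun n ↦ (Z (-n)).unop, ⟨e.unop.symm⟩,
      fun n m hnm ↦ isLinked_dual_iff.1 (h (-m) (-n) (by lia))⟩
  · rintro ⟨Z, ⟨e⟩, h⟩
    exact ⟨fun n ↦ op (Z (-n)), ⟨e.symm.op⟩,
      fun n m hnm ↦ isLinked_dual_iff.2 (h (-m) (-n) (by lia))⟩

end NakayamaFunctor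

end

/-! ### Resolutions by Gorenstein projective objects -/

section

variable {A : Type u} [Category.{v} A] [Abelian A]

lemma HasResolution.mono {𝒳 𝒴 : ObjectProperty A} (h : ∀ X, 𝒳 X → 𝒴 X) {n : ℕ} {X : A}
    (hX : HasResolution 𝒳 n X) : HasResolution 𝒴 n X := by
  induction hX with
  | zero e h₀ => exact .zero e (h _ h₀)
  | succ i p w hS h₀ _ hK => exact .succ i p w hS (h _ h₀) hK

lemma HasCoresolution.op {𝒳 : ObjectProperty Aᵒᵖ} {𝒴 : ObjectProperty A}
    (h : ∀ X, 𝒴 X → 𝒳 (op X)) {n : ℕ} {X : A}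
    (hX : HasCoresolution 𝒴 n X) : HasResolution 𝒳 n (op X) := by
  induction hX with
  | zero e h₀ => exact .zero e.op (h _ h₀)
  | succ i p w hS h₀ _ hK => exact .succ p.op i.op _ (shortExact_op hS) (h _ h₀) hK

lemma HasResolution.unop {𝒳 : ObjectProperty Aᵒᵖ} {𝒴 : ObjectProperty A}
    (h : ∀ X, 𝒳 X → 𝒴 X.unop) {n : ℕ} {X : Aᵒᵖ}
    (hX : HasResolution 𝒳 n X) : HasCoresolution 𝒴 n X.unop := by
  induction hX with
  | zero e h₀ => exact .zero e.unop (h _ h₀)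
  | succ i p w hS h₀ _ hK => exact .succ p.unop i.unop _ (shortExact_unop hS) (h _ h₀) hK

namespace NakayamaFunctor

open FunctorialEmbedding

variable {P : A ⥤ A} {N : NakayamaFunctor P} {hP : IsGenerating P}

lemma hasCoresolution_iff (n : ℕ) (X : A) : HasCoresolution (IsGorensteinInjective N) n X ↔
    HasResolution (IsGorensteinProjective N.dual) n (op X) :=
  ⟨HasCoresolution.op fun _ ↦ (N.isGorensteinProjective_dual_iff _).2,
    HasResolution.unop fun _ ↦ (N.isGorensteinProjective_dual_iff _).1⟩

lemma hasResolution_of_coVanish {𝒳 : ObjectProperty A}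
    (h𝒳 : ∀ X, (N.leftEmbedding hP).CoAcyclic X → 𝒳 X) {n : ℕ} {X : A}
    (hX : ∀ i ≥ n, (N.leftEmbedding hP).CoVanish i X) : HasResolution 𝒳 n X := by
  induction n generalizing X with
  | zero => exact .zero (Iso.refl _) (h𝒳 _ fun i ↦ hX i i.zero_le)
  | succ n hn =>
    obtain ⟨K, Q, f, g, w, hQ, hS⟩ := N.exists_cover hP X
    have hQ' := N.coAcyclic_of_isProjective hP hQ
    exact .succ f g w hS (h𝒳 _ hQ')
      (hn fun i hi ↦ (coVanish_succ_iff hS hQ' i).1 (hX (i + 1) (by lia)))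

lemma coVanish_of_hasResolution {n : ℕ} {X : A}
    (hX : HasResolution (N.leftEmbedding hP).CoAcyclic n X) (i : ℕ) (hi : n ≤ i) :
    (N.leftEmbedding hP).CoVanish i X := by
  induction hX generalizing i with
  | zero e h₀ => exact .of_retract (Retract.ofIso e.symm) (h₀ i)
  | succ f g w hS h₀ _ hK =>
    obtain ⟨i, rfl⟩ := Nat.exists_eq_succ_of_ne_zero (n := i) (by lia)
    exact (coVanish_succ_iff hS h₀ i).2 (hK i (by lia))

/-- `ν`-acyclicity descends to the kernels of the resolution; biacyclicity then climbs back from the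
last kernel by `IsBiacyclic.X₃`. -/
lemma isBiacyclic_of_hasResolution {n : ℕ} {X : A} (hX : HasResolution (N.IsBiacyclic hP) n X)
    (hX' : (N.leftEmbedding hP).CoAcyclic X) : N.IsBiacyclic hP X := by
  induction hX with
  | zero e h₀ => exact h₀.of_iso e
  | succ f g w hS h₀ _ hK => exact .X₃ hS (hK (.X₁ hS h₀.coAcyclic hX')) h₀ hX'

/-- If the functors `Rⁱν⁻` vanish for large `i`, then all the objects on which the higher left
derived functors of `ν` vanish are Gorenstein projective. -/
lemma isBiacyclic_of_coAcyclic {n : ℕ} (hn : ∀ X, ∀ i ≥ n, (N.rightEmbedding hP).Vanish i X)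
    {X : A} (hX : (N.leftEmbedding hP).CoAcyclic X) : N.IsBiacyclic hP X := by
  -- Each syzygy raises the index by one; after `k` of them it reaches the range where `Rⁱν⁻`
  -- vanishes on all objects.
  have h₁ (k : ℕ) : ∀ {X : A} (_ : (N.leftEmbedding hP).CoAcyclic X) (i : ℕ), n ≤ i + k →
      (N.rightEmbedding hP).Vanish i (N.ν.obj X) := by
    induction k with
    | zero => exact fun _ i hi ↦ hn _ _ (by lia)
    | succ k hk =>
      intro X hX i hi
      obtain ⟨K, Q, f, g, w, hQ, hS⟩ := N.exists_cover hP X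
      exact (vanish_succ_X₁_iff (CoAcyclic.shortExact_map hS hX)
        (N.acyclic_of_isInjective hP (N.isInjective_ν hQ)) i).1
        (hk (.X₁ hS (N.coAcyclic_of_isProjective hP hQ) hX) (i + 1) (by lia))
  have h₂ {X : A} (hX : (N.leftEmbedding hP).CoAcyclic X) :
      (N.rightEmbedding hP).Acyclic (N.ν.obj X) := fun i ↦ h₁ n hX i (by lia)
  have h₃ {X : A} (hX : (N.leftEmbedding hP).CoAcyclic X) : Epi (N.unitApp X) := by
    obtain ⟨K, Q, f, g, w, hQ, hS⟩ := N.exists_cover hP X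
    have hK := CoAcyclic.X₁ hS (N.coAcyclic_of_isProjective hP hQ) hX
    have hS' := Acyclic.shortExact_map (CoAcyclic.shortExact_map hS hX) (h₂ hK)
    have : Epi (N.νR.map (N.ν.map g)) := hS'.epi_g
    have : IsIso (N.unitApp Q) := N.isIso_unit_of_isProjective hQ
    exact N.epi_unitApp_of_epi (g := g)
  refine ⟨hX, h₂ hX, ?_⟩
  obtain ⟨K, Q, f, g, w, hQ, hS⟩ := N.exists_cover hP X
  have hK := CoAcyclic.X₁ hS (N.coAcyclic_of_isProjective hP hQ) hX
  exact N.isIso_unitApp_X₃ hS (Acyclic.shortExact_map (CoAcyclic.shortExact_map hS hX) (h₂ hK))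
    (h₃ hK) (N.isIso_unit_of_isProjective hQ)

end NakayamaFunctor

end

/-! ### Vanishing of right derived functors from the vanishing of left derived functors -/

section

variable {C : Type u₁} [Category.{v₁} C] [Abelian C] {D : Type u₂} [Category.{v₂} D] [Abelian D]

lemma exactAt_of_isZero_X {K : CochainComplex C ℤ} {n : ℤ} (h : IsZero (K.X n)) : K.ExactAt n :=
  ShortComplex.exact_of_isZero_X₂ _ h

lemma exactAt_X₃ {S : ShortComplex (CochainComplex C ℤ)} (hS : S.ShortExact) {n m : ℤ}
    (hnm : n + 1 = m) (h₂ : S.X₂.ExactAt n) (h₁ : S.X₁.ExactAt m) : S.X₃.ExactAt n := by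
  rw [HomologicalComplex.exactAt_iff_isZero_homology] at *
  exact (hS.homology_exact₃ n m hnm).isZero_of_both_zeros (h₂.eq_of_src _ _) (h₁.eq_of_tgt _ _)

lemma homologyMap_eq_zero_of_comm {K K' L L' : CochainComplex C ℤ} {f' : K' ⟶ L'} {d' : L' ⟶ L}
    {d : K' ⟶ K} {f : K ⟶ L} (comm : f' ≫ d' = d ≫ f) [QuasiIso d] {n : ℤ}
    (h : HomologicalComplex.homologyMap f' n = 0) : HomologicalComplex.homologyMap f n = 0 := by
  rw [← cancel_epi (HomologicalComplex.homologyMap d n), ← HomologicalComplex.homologyMap_comp,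
    ← comm, HomologicalComplex.homologyMap_comp, h, zero_comp, comp_zero]

lemma quasiIso_of_iso_comp {K L M : CochainComplex C ℤ} {e : K ≅ L} {f : L ⟶ M} {g : K ⟶ M}
    (h : e.hom ≫ f = g) (hf : QuasiIso f) : QuasiIso g := by
  rw [← h]; infer_instance

lemma shortExact_X {S : ShortComplex (CochainComplex C ℤ)} (hS : S.ShortExact) (n : ℤ) :
    (ShortComplex.mk (S.f.f n) (S.g.f n)
      (by rw [← HomologicalComplex.comp_f, S.zero]; rfl)).ShortExact :=
  hS.map_of_exact (HomologicalComplex.eval C (.up ℤ) n)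

lemma shortExact_map_complex (F : C ⥤ D) [F.Additive] {S : ShortComplex (CochainComplex C ℤ)}
    (h : ∀ n, (ShortComplex.mk (F.map (S.f.f n)) (F.map (S.g.f n))
      (map_comp_eq_zero F (by rw [← HomologicalComplex.comp_f, S.zero]; rfl))).ShortExact) :
    (S.map (F.mapHomologicalComplex (.up ℤ))).ShortExact :=
  HomologicalComplex.shortExact_of_degreewise_shortExact _ h

/-- The morphism from a complex to its opcycles in a given degree. -/
noncomputable def toSingleOpcycles (K : CochainComplex C ℤ) (n : ℤ) :
    K ⟶ (HomologicalComplex.single C (.up ℤ) n).obj (K.opcycles n) :=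
  HomologicalComplex.mkHomToSingle (K.pOpcycles n) (fun _ _ ↦ K.d_pOpcycles _ _)

/-- The map on `Hⁿ` is, up to isomorphism, the inclusion of `Hⁿ` into the opcycles, so it vanishes
only if `Hⁿ` does. -/
lemma exactAt_of_homologyMap_toSingleOpcycles (K : CochainComplex C ℤ) (n : ℤ)
    (h : HomologicalComplex.homologyMap (toSingleOpcycles K n) n = 0) : K.ExactAt n := by
  let L := (HomologicalComplex.single C (.up ℤ) n).obj (K.opcycles n)
  have h₁ : IsIso (L.pOpcycles n) := L.isIso_pOpcycles _ n rfl (by simp [L])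
  have h₂ : K.pOpcycles n ≫ HomologicalComplex.opcyclesMap (toSingleOpcycles K n) n =
      K.pOpcycles n ≫ (HomologicalComplex.singleObjXSelf (.up ℤ) n (K.opcycles n)).inv ≫
        L.pOpcycles n := by
    rw [HomologicalComplex.p_opcyclesMap, toSingleOpcycles, HomologicalComplex.mkHomToSingle_f,
      Category.assoc]
  have h₃ : IsIso (HomologicalComplex.opcyclesMap (toSingleOpcycles K n) n) := by
    rw [cancel_epi] at h₂
    rw [h₂]
    infer_instance
  have h₄ := HomologicalComplex.homologyι_naturality (toSingleOpcycles K n) n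
  rw [h, zero_comp] at h₄
  rw [HomologicalComplex.exactAt_iff_isZero_homology, IsZero.iff_id_eq_zero,
    ← cancel_mono (K.homologyι n),
    ← cancel_mono (HomologicalComplex.opcyclesMap (toSingleOpcycles K n) n)]
  simp [← h₄]

namespace FunctorialEmbedding

variable {F : C ⥤ D} [F.Additive] (E : FunctorialEmbedding F)

/-- The embedding of a complex in a complex consisting of acyclic objects. -/
def complexEmb (K : CochainComplex C ℤ) : K ⟶ (E.T.mapHomologicalComplex _).obj K where
  f n := E.emb (K.X n)
  comm' _ _ _ := (E.η.naturality _).symm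

instance (K : CochainComplex C ℤ) : Mono (E.complexEmb K) :=
  have (n : ℤ) : Mono ((E.complexEmb K).f n) := E.mono_η _
  HomologicalComplex.mono_of_mono_f _ this

lemma complexEmb_naturality {K L : CochainComplex C ℤ} (f : K ⟶ L) :
    f ≫ E.complexEmb L = E.complexEmb K ≫ (E.T.mapHomologicalComplex _).map f := by
  ext n
  exact E.η.naturality (f.f n)

/-- The short exact sequence starting with the embedding of a complex in a complex consisting
of acyclic objects. -/
noncomputable def complexSequence (K : CochainComplex C ℤ) : ShortComplex (CochainComplex C ℤ) :=
  ShortComplex.mk (E.complexEmb K) (cokernel.π (E.complexEmb K)) (cokernel.condition _)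

lemma complexSequence_shortExact (K : CochainComplex C ℤ) : (E.complexSequence K).ShortExact where
  exact := ShortComplex.exact_of_g_is_cokernel _ (cokernelIsCokernel _)
  mono_f := inferInstanceAs (Mono (E.complexEmb K))
  epi_g := epi_of_isColimit_cofork
    (c := CokernelCofork.ofπ (cokernel.π (E.complexEmb K)) (cokernel.condition _))
    (cokernelIsCokernel _)

/-- The functoriality of `complexSequence`. -/
noncomputable def complexSequenceMap {K L : CochainComplex C ℤ} (f : K ⟶ L) :
    E.complexSequence K ⟶ E.complexSequence L where
  τ₁ := f
  τ₂ := (E.T.mapHomologicalComplex _).map f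
  τ₃ := cokernel.map _ _ _ _ (E.complexEmb_naturality f).symm
  comm₁₂ := E.complexEmb_naturality f
  comm₂₃ := (cokernel.π_desc _ _ _).symm

lemma exactAt_T {K : CochainComplex C ℤ} {n : ℤ} (h : K.ExactAt n) :
    ((E.T.mapHomologicalComplex _).obj K).ExactAt n := by
  have h' : ∀ S : ShortComplex C, S.Exact → (S.map E.T).Exact :=
    (E.T.exact_tfae.out 0 1).1 fun _ ↦ E.shortExact_map _
  exact h' _ h

variable [PreservesFiniteLimits F]

lemma exactAt_map_T {K : CochainComplex C ℤ} {n : ℤ} (h : K.ExactAt n) :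
    ((F.mapHomologicalComplex _).obj ((E.T.mapHomologicalComplex _).obj K)).ExactAt n := by
  have h' : ∀ S : ShortComplex C, S.Exact → (S.map (E.T ⋙ F)).Exact :=
    ((E.T ⋙ F).exact_tfae.out 0 1).1
      fun S hS ↦ Acyclic.shortExact_map (E.shortExact_map S hS) (E.acyclic_T _)
  exact h' _ h

variable {E}

/-- Morally `f` is zero because there are no maps in the derived category from degrees `≤ 0` to
degrees `> 0`. The induction avoids unbounded derived functors: since `F(T K)` is exact in positive
degrees, the connecting map from the cokernel of `K ⟶ T K` is onto `Hᵖ⁺¹(F K)`, and the cokernels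
satisfy the same hypotheses. -/
lemma homologyMap_map_eq_zero (p : ℕ) {K L : CochainComplex C ℤ} (f : K ⟶ L)
    (hK : ∀ n, E.Acyclic (K.X n)) (hL : ∀ n, E.Acyclic (L.X n)) (hK' : ∀ n > 0, K.ExactAt n)
    (hL' : ∀ n ≤ 0, IsZero (L.X n)) :
    HomologicalComplex.homologyMap ((F.mapHomologicalComplex (.up ℤ)).map f) p = 0 := by
  induction p generalizing K L with
  | zero =>
    have : ((F.mapHomologicalComplex (.up ℤ)).obj L).ExactAt (0 : ℕ) :=
      exactAt_of_isZero_X (F.map_isZero (hL' _ (by simp)))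
    exact this.isZero_homology.eq_of_tgt _ _
  | succ p hp =>
    have S (K : CochainComplex C ℤ) := E.complexSequence_shortExact K
    have hS {K : CochainComplex C ℤ} (hK : ∀ n, E.Acyclic (K.X n)) :=
      shortExact_map_complex F (S := E.complexSequence K)
        (fun n ↦ Acyclic.shortExact_map (shortExact_X (S K) n) (hK n))
    have h := HomologicalComplex.HomologySequence.δ_naturality
      ((F.mapHomologicalComplex (.up ℤ)).mapShortComplex.map (E.complexSequenceMap f))
      (hS hK) (hS hL) p (p + 1 : ℕ) (by simp)
    have hc {K : CochainComplex C ℤ} (hK : ∀ n, E.Acyclic (K.X n)) (n : ℤ) :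
        E.Acyclic ((E.complexSequence K).X₃.X n) :=
      .X₃ (shortExact_X (S K) n) (hK n) (E.acyclic_T _)
    have h' := hp (E.complexSequenceMap f).τ₃ (hc hK) (hc hL)
      (fun n hn ↦ exactAt_X₃ (S K) rfl (E.exactAt_T (hK' _ hn)) (hK' _ (by lia)))
      (fun n hn ↦ by
        have : Epi ((E.complexSequence L).g.f n) := (shortExact_X (S L) n).epi_g
        exact IsZero.of_epi ((E.complexSequence L).g.f n) (E.T.map_isZero (hL' n hn)))
    have hepi : Epi ((hS hK).δ p (p + 1 : ℕ) (by simp)) :=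
      ((hS hK).homology_exact₁ p (p + 1 : ℕ) (by simp)).epi_f
        ((E.exactAt_map_T (hK' _ (by lia))).isZero_homology.eq_of_tgt _ _)
    exact hepi.left_cancellation _ _
      ((h.trans ((congrArg (· ≫ _) h').trans zero_comp)).trans comp_zero.symm)

end FunctorialEmbedding

end

/-! ### Comparison of `ν` and `ν⁻` on complexes of `ν`-acyclic objects -/

section

variable {A : Type u} [Category.{v} A] [Abelian A]

lemma mappingCone_shortExact {K L : CochainComplex A ℤ} (φ : K ⟶ L) (n : ℤ) :
    ∃ (f : L.X n ⟶ (CochainComplex.mappingCone φ).X n)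
      (g : (CochainComplex.mappingCone φ).X n ⟶ K.X (n + 1)) (w : f ≫ g = 0),
      (ShortComplex.mk f g w).ShortExact :=
  ⟨(CochainComplex.mappingCone.inr φ).f n, (CochainComplex.mappingCone.fst φ).1.v n (n + 1) rfl,
    CochainComplex.mappingCone.inr_f_fst_v _ _ _ _,
    (ShortComplex.Splitting.mk (S := ShortComplex.mk _ _ _)
      ((CochainComplex.mappingCone.snd φ).v n n (add_zero n))
      ((CochainComplex.mappingCone.inl φ).v (n + 1) n (by lia)) (by simp) (by simp) (by
        simp [CochainComplex.mappingCone.ext_from_iff _ (n + 1) n rfl])).shortExact⟩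

namespace NakayamaFunctor

open FunctorialEmbedding CochainComplex

variable {P : A ⥤ A} (N : NakayamaFunctor P)

instance : (N.I ⋙ P).Additive :=
  have := N.additive_I
  have := N.additive_P
  inferInstance

/-- The functorial epimorphism from a `P`-projective object. -/
def coverApp (X : A) : (N.I ⋙ P).obj X ⟶ X := N.adjI.counit.app X

lemma coverApp_naturality {X Y : A} (f : X ⟶ Y) :
    (N.I ⋙ P).map f ≫ N.coverApp Y = N.coverApp X ≫ f :=
  N.adjI.counit.naturality f

/-- The functorial epimorphism from a complex of `P`-projective objects. -/
def complexCover (K : CochainComplex A ℤ) : ((N.I ⋙ P).mapHomologicalComplex _).obj K ⟶ K where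
  f n := N.coverApp (K.X n)
  comm' _ _ _ := (N.coverApp_naturality _).symm

lemma complexCover_naturality {K L : CochainComplex A ℤ} (f : K ⟶ L) :
    ((N.I ⋙ P).mapHomologicalComplex _).map f ≫ N.complexCover L = N.complexCover K ≫ f := by
  ext n
  exact N.coverApp_naturality (f.f n)

/-- The short exact sequence given by the functorial epimorphism from a complex of `P`-projective
objects. -/
noncomputable def coverSequence (K : CochainComplex A ℤ) : ShortComplex (CochainComplex A ℤ) :=
  ShortComplex.mk (kernel.ι (N.complexCover K)) (N.complexCover K) (kernel.condition _)

/-- The functoriality of `coverSequence`. -/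
noncomputable def coverSequenceMap {K L : CochainComplex A ℤ} (f : K ⟶ L) :
    N.coverSequence K ⟶ N.coverSequence L where
  τ₁ := kernel.map _ _ _ _ (N.complexCover_naturality f).symm
  τ₂ := ((N.I ⋙ P).mapHomologicalComplex _).map f
  τ₃ := f
  comm₁₂ := kernel.lift_ι _ _ _
  comm₂₃ := N.complexCover_naturality f

variable (hP : IsGenerating P)

include hP in
lemma coverSequence_shortExact (K : CochainComplex A ℤ) : (N.coverSequence K).ShortExact where
  exact := ShortComplex.exact_of_f_is_kernel _ (kernelIsKernel _)
  mono_f := mono_of_isLimit_fork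
    (c := KernelFork.ofι (kernel.ι (N.complexCover K)) (kernel.condition _)) (kernelIsKernel _)
  epi_g :=
    have (n : ℤ) : Epi ((N.complexCover K).f n) := N.epi_counit hP (K.X n)
    HomologicalComplex.epi_of_epi_f _ this

lemma coAcyclic_cover (X : A) : (N.leftEmbedding hP).CoAcyclic ((N.I ⋙ P).obj X) :=
  N.coAcyclic_of_isProjective hP ⟨_, ⟨Retract.refl _⟩⟩

/-- The unit of the adjunction `ν ⊣ ν⁻` on complexes. -/
def complexUnit (K : CochainComplex A ℤ) :
    K ⟶ (N.νR.mapHomologicalComplex _).obj ((N.ν.mapHomologicalComplex _).obj K) where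
  f n := N.unitApp (K.X n)
  comm' _ _ _ := (N.unitApp_naturality _).symm

lemma complexUnit_naturality {K L : CochainComplex A ℤ} (f : K ⟶ L) :
    f ≫ N.complexUnit L = N.complexUnit K ≫
      (N.νR.mapHomologicalComplex _).map ((N.ν.mapHomologicalComplex _).map f) := by
  ext n
  exact N.unitApp_naturality (f.f n)

variable {N hP}

/-- Induction on `k`, replacing `K` and `L` by the quasi-isomorphic cones of `kernel ⟶ cover`. The
cone terms are extensions of syzygies by `P`-projectives, so for `L` the vanishing bound `k` drops
by one, at the cost of one more degree where it may be nonzero; the two losses match. -/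
lemma homologyMap_eq_zero (h : ∀ G, (N.leftEmbedding hP).CoAcyclic G → N.IsBiacyclic hP G)
    (k p : ℕ) {K L : CochainComplex A ℤ} (f : K ⟶ L)
    (hK : ∀ n, (N.leftEmbedding hP).CoAcyclic (K.X n))
    (hL : ∀ n, ∀ i ≥ k, (N.leftEmbedding hP).CoVanish i (L.X n))
    (hK' : ∀ n > 0, ((N.ν.mapHomologicalComplex (.up ℤ)).obj K).ExactAt n)
    (hL' : ∀ n ≤ (k : ℤ), IsZero (L.X n)) :
    HomologicalComplex.homologyMap f p = 0 := by
  induction k generalizing K L with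
  | zero =>
    have hK (n : ℤ) := h _ (hK n)
    have hL (n : ℤ) := h _ (fun i ↦ hL n i i.zero_le)
    have := homologyMap_map_eq_zero p ((N.ν.mapHomologicalComplex (.up ℤ)).map f)
      (fun n ↦ (hK n).acyclic) (fun n ↦ (hL n).acyclic) hK' (fun n hn ↦ N.ν.map_isZero (hL' n hn))
    -- All terms of `L` are now biacyclic, so `L ≅ ν⁻νL` and `f` factors through `ν⁻ν(f)`, which is
    -- zero on homology.
    have h' (n : ℤ) : IsIso ((N.complexUnit L).f n) := (hL n).isIso_unit
    have h'' : IsIso (N.complexUnit L) := HomologicalComplex.Hom.isIso_of_components _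
    rw [← cancel_mono (HomologicalComplex.homologyMap (N.complexUnit L) p),
      ← HomologicalComplex.homologyMap_comp, N.complexUnit_naturality,
      HomologicalComplex.homologyMap_comp, this, comp_zero, zero_comp]
  | succ k hk =>
    have S (K : CochainComplex A ℤ) := N.coverSequence_shortExact hP K
    have hS := shortExact_map_complex N.ν (S := N.coverSequence K)
      (fun n ↦ CoAcyclic.shortExact_map (shortExact_X (S K) n) (hK n))
    have q (K : CochainComplex A ℤ) := mappingCone.quasiIso_descShortComplex (S K)
    have hq := mappingCone.quasiIso_descShortComplex hS
    have comm := mappingCone.map_descShortComplex _ _ (N.coverSequenceMap f)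
    have := hk (mappingCone.map _ _ _ _ (N.coverSequenceMap f).comm₁₂.symm) (fun n ↦ by
        obtain ⟨a, b, w, T⟩ := mappingCone_shortExact (N.coverSequence K).f n
        exact .X₂ T (N.coAcyclic_cover hP _)
          (.X₁ (shortExact_X (S K) (n + 1)) (N.coAcyclic_cover hP _) (hK _)))
      (fun n i hi ↦ by
        obtain ⟨a, b, w, T⟩ := mappingCone_shortExact (N.coverSequence L).f n
        exact .X₂ T (N.coAcyclic_cover hP _ i)
          (.X₁ (shortExact_X (S L) (n + 1)) (N.coAcyclic_cover hP _ i) (hL _ _ (by lia))))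
      (fun n hn ↦ by
        have : QuasiIso ((N.ν.mapHomologicalComplex (.up ℤ)).map
            (mappingCone.descShortComplex (N.coverSequence K))) :=
          quasiIso_of_iso_comp
            (mappingCone.mapHomologicalComplexIso_hom_descShortComplex N.ν (N.coverSequence K)) hq
        exact (exactAt_iff_of_quasiIsoAt ((N.ν.mapHomologicalComplex (.up ℤ)).map
          (mappingCone.descShortComplex (N.coverSequence K))) n).2 (hK' n hn))
      (fun n hn ↦ by
        obtain ⟨a, b, w, T⟩ := mappingCone_shortExact (N.coverSequence L).f n
        have h₁ (n : ℤ) (hn : n ≤ (k + 1 : ℕ)) : IsZero ((N.coverSequence L).X₂.X n) :=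
          (N.I ⋙ P).map_isZero (hL' n hn)
        have : Mono ((N.coverSequence L).f.f (n + 1)) := (shortExact_X (S L) _).mono_f
        exact T.exact.isZero_of_both_zeros ((h₁ n (by lia)).eq_of_src _ _)
          ((IsZero.of_mono ((N.coverSequence L).f.f (n + 1))
            (h₁ (n + 1) (by lia))).eq_of_tgt _ _))
    let d : mappingCone (N.coverSequence K).f ⟶ K :=
      mappingCone.descShortComplex (N.coverSequence K)
    have hd : QuasiIso d := q K
    exact homologyMap_eq_zero_of_comm comm this

/-- If `LᵢνX = 0` for all `i > n` and all `X`, and if all the objects on which the higher left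
derived functors of `ν` vanish are Gorenstein projective, then `Rⁱν⁻X = 0` for all `i > n`. -/
lemma vanish_of_coVanish (h : ∀ G, (N.leftEmbedding hP).CoAcyclic G → N.IsBiacyclic hP G)
    {n : ℕ} (hn : ∀ X, ∀ i ≥ n, (N.leftEmbedding hP).CoVanish i X) (X : A) (i : ℕ) (hi : n ≤ i) :
    (N.rightEmbedding hP).Vanish i X := by
  let E := N.rightEmbedding hP
  obtain ⟨J, hJ, f, hf, hJ'⟩ := E.exists_quasiIso ((CochainComplex.singleFunctor A 0).obj X) 0
  have hJac (n : ℤ) : E.Acyclic (J.X n) := by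
    obtain ⟨Y, ⟨r⟩⟩ := hJ' n
    exact E.acyclic_of_retract r
  have hJinj (n : ℤ) : IsSummandOfImage N.I (J.X n) := by
    obtain ⟨Y, ⟨r⟩⟩ := hJ' n
    exact ⟨P.obj Y, ⟨r⟩⟩
  have hex (n : ℤ) (hn : 0 < n) : J.ExactAt n :=
    (exactAt_iff_of_quasiIsoAt f n).1 (HomologicalComplex.exactAt_single_obj _ _ _ _ hn.ne')
  have e := cyclesIsoOfQuasiIso f
  refine Vanish.of_retract (Retract.ofIso e.symm) ((E.vanish_cycles_iff J hJac hex i 0).2 ?_)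
  let Q := (N.νR.mapHomologicalComplex (.up ℤ)).obj J
  -- The counit is an isomorphism on `I`-injectives, so `νQ ≅ J`.
  have hQ (n : ℤ) (hn : 0 < n) : ((N.ν.mapHomologicalComplex (.up ℤ)).obj Q).ExactAt n := by
    let c : (N.ν.mapHomologicalComplex (.up ℤ)).obj Q ⟶ J :=
      { f n := N.counitApp (J.X n)
        comm' _ _ _ := (N.counitApp_naturality _).symm }
    have hc (n : ℤ) : IsIso (c.f n) := N.isIso_counit_of_isInjective (hJinj n)
    have := HomologicalComplex.Hom.isIso_of_components c
    exact (exactAt_iff_of_quasiIsoAt c n).2 (hex n hn)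
  rw [show ((0 : ℕ) : ℤ) + i + 1 = (i + 1 : ℕ) by simp]
  refine exactAt_of_homologyMap_toSingleOpcycles Q _ ?_
  exact homologyMap_eq_zero h n (i + 1)
    (toSingleOpcycles Q (i + 1 : ℕ))
    (fun m ↦ N.coAcyclic_of_isProjective hP (N.isProjective_νR (hJinj m)))
    (fun m j hj ↦ hn _ j hj) hQ
    (fun m hm ↦ HomologicalComplex.isZero_single_obj_X _ _ _ _ (by lia))

end NakayamaFunctor

end

/-! ### Global dimensions -/

section

lemma eq_natCast_of_isLeast {f : ℕ∞} {S : Set ℕ} (h : ∀ k : ℕ, f ≤ k ↔ k ∈ S) {n : ℕ}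
    (hn : IsLeast S n) : f = n := by
  refine le_antisymm ((h n).2 hn.1) ?_
  by_contra! hf
  obtain ⟨k, rfl⟩ := ENat.ne_top_iff_exists.1 hf.ne_top
  exact hf.not_ge (Nat.cast_le.2 (hn.2 ((h k).1 le_rfl)))

variable {A : Type u} [Category.{v} A] [Abelian A]

lemma resolutionDim_le_iff (𝒳 : ObjectProperty A) (X : A) (n : ℕ) :
    resolutionDim 𝒳 X ≤ n ↔ ∃ k ≤ n, HasResolution 𝒳 k X := by
  refine ⟨fun h ↦ ?_, fun ⟨k, hk, hX⟩ ↦ (iInf₂_le k hX).trans (Nat.cast_le.2 hk)⟩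
  by_contra! h'
  have : ((n + 1 : ℕ) : ℕ∞) ≤ resolutionDim 𝒳 X := le_iInf₂ fun k hk ↦ Nat.cast_le.2 (by
    by_contra! hkn
    exact h' k (by lia) hk)
  exact absurd (Nat.cast_le.1 (this.trans h)) (by simp)

lemma globalResolutionDim_le_iff (𝒳 : ObjectProperty A) (n : ℕ) :
    globalResolutionDim 𝒳 ≤ n ↔ ∀ X, ∃ k ≤ n, HasResolution 𝒳 k X := by
  simp only [globalResolutionDim, iSup_le_iff, resolutionDim_le_iff]

namespace NakayamaFunctor

open FunctorialEmbedding

variable {P : A ⥤ A} (N : NakayamaFunctor P)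

lemma globalCoresolutionDim_eq : globalCoresolutionDim (IsGorensteinInjective N) =
    globalResolutionDim (IsGorensteinProjective N.dual) := by
  have h (X : A) : coresolutionDim (IsGorensteinInjective N) X =
      resolutionDim (IsGorensteinProjective N.dual) (op X) := by
    simp only [coresolutionDim, resolutionDim, hasCoresolution_iff]
  simp only [globalCoresolutionDim, globalResolutionDim, h]
  exact equivToOpposite.iSup_comp (g := resolutionDim (IsGorensteinProjective N.dual))

variable (hP : IsGenerating P)

/-- The functors `Lᵢν` vanish for `i > n`. -/
def LeftVanishAbove (n : ℕ) : Prop := ∀ X, ∀ i ≥ n, (N.leftEmbedding hP).CoVanish i X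

/-- The functors `Rⁱν⁻` vanish for `i > n`. -/
def RightVanishAbove (n : ℕ) : Prop := ∀ X, ∀ i ≥ n, (N.rightEmbedding hP).Vanish i X

lemma leftVanishAbove_dual_iff (n : ℕ) :
    N.dual.LeftVanishAbove (N.isGenerating_dual hP) n ↔ N.RightVanishAbove hP n :=
  ⟨fun h _ i hi ↦ (N.coVanish_dual_iff hP i).1 (h _ i hi),
    fun h X i hi ↦ (N.coVanish_dual_iff hP (X := X.unop) i).2 (h _ i hi)⟩

lemma rightVanishAbove_dual_iff (n : ℕ) :
    N.dual.RightVanishAbove (N.isGenerating_dual hP) n ↔ N.LeftVanishAbove hP n :=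
  ⟨fun h X ↦ h (op X), fun h X ↦ h X.unop⟩

variable {N hP}

/-- Some bound `m` on `Rⁱν⁻` suffices to make `ν`-acyclic objects Gorenstein projective; the sharper
bound `n` then transfers. -/
lemma LeftVanishAbove.right {n m : ℕ} (h : N.LeftVanishAbove hP n)
    (hm : N.RightVanishAbove hP m) : N.RightVanishAbove hP n :=
  fun X i hi ↦ vanish_of_coVanish (fun _ ↦ isBiacyclic_of_coAcyclic hm) h X i hi

lemma RightVanishAbove.left {n m : ℕ} (h : N.RightVanishAbove hP n)
    (hm : N.LeftVanishAbove hP m) : N.LeftVanishAbove hP n := by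
  rw [← leftVanishAbove_dual_iff] at h
  rw [← rightVanishAbove_dual_iff] at hm ⊢
  exact h.right hm

variable (N hP)

lemma globalResolutionDim_le_iff (n : ℕ) :
    globalResolutionDim (IsGorensteinProjective N) ≤ n ↔
      N.LeftVanishAbove hP n ∧ N.RightVanishAbove hP n := by
  rw [NakayamaGorenstein.globalResolutionDim_le_iff]
  constructor
  · intro h
    have hl : N.LeftVanishAbove hP n := fun X i hi ↦ by
      obtain ⟨k, hk, hX⟩ := h X
      exact coVanish_of_hasResolution
        (hX.mono fun Y hY ↦ ((N.isGorensteinProjective_iff hP Y).1 hY).coAcyclic) i (hk.trans hi)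
    -- No bound on `Rⁱν⁻` is known here; that `ν`-acyclic objects are Gorenstein projective comes
    -- from their finite Gorenstein resolutions instead.
    refine ⟨hl, fun X i hi ↦ vanish_of_coVanish (fun G hG ↦ ?_) hl X i hi⟩
    obtain ⟨k, hk, hX⟩ := h G
    exact isBiacyclic_of_hasResolution
      (hX.mono fun Y hY ↦ (N.isGorensteinProjective_iff hP Y).1 hY) hG
  · exact fun ⟨hl, hr⟩ X ↦ ⟨n, le_rfl, hasResolution_of_coVanish
      (fun Y hY ↦ (N.isGorensteinProjective_iff hP Y).2 (isBiacyclic_of_coAcyclic hr hY)) (hl X)⟩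

lemma globalCoresolutionDim_le_iff (n : ℕ) :
    globalCoresolutionDim (IsGorensteinInjective N) ≤ n ↔
      N.LeftVanishAbove hP n ∧ N.RightVanishAbove hP n := by
  rw [globalCoresolutionDim_eq, N.dual.globalResolutionDim_le_iff (N.isGenerating_dual hP),
    leftVanishAbove_dual_iff, rightVanishAbove_dual_iff, and_comm]

lemma leftDerivedVanishAbove_iff [HasDerivedCategory.{w₂} Aᵒᵖ] [HasLeftDerived.{w₂} N.ν] (n : ℕ) :
    LeftDerivedVanishAbove.{w₂} N n ↔ N.LeftVanishAbove hP n := by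
  have key (i : ℕ) (X : A) : IsZero ((leftDerived.{w₂, w₂} N.ν (i + 1)).obj X) ↔
      (N.leftEmbedding hP).CoVanish i X :=
    ⟨fun h ↦ ((N.leftEmbedding hP).isZero_rightDerived_succ_iff (op X) i).1 h.op,
      fun h ↦ (((N.leftEmbedding hP).isZero_rightDerived_succ_iff (op X) i).2 h).unop⟩
  refine ⟨fun h X i hi ↦ (key i X).1 (h _ (by lia) X), fun h i hi X ↦ ?_⟩
  obtain ⟨i, rfl⟩ := Nat.exists_eq_succ_of_ne_zero (n := i) (by lia)
  exact (key i X).2 (h X i (by lia))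

lemma rightDerivedVanishAbove_iff [HasDerivedCategory.{w₁} A] [HasRightDerived.{w₁} N.νR] (n : ℕ) :
    RightDerivedVanishAbove.{w₁} N n ↔ N.RightVanishAbove hP n := by
  have key (i : ℕ) (X : A) := (N.rightEmbedding hP).isZero_rightDerived_succ_iff (F := N.νR) X i
  refine ⟨fun h X i hi ↦ (key i X).1 (h _ (by lia) X), fun h i hi X ↦ ?_⟩
  obtain ⟨i, rfl⟩ := Nat.exists_eq_succ_of_ne_zero (n := i) (by lia)
  exact (key i X).2 (h X i (by lia))

lemma exists_vanishAbove_iff {f : ℕ∞}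
    (hf : ∀ n : ℕ, f ≤ n ↔ N.LeftVanishAbove hP n ∧ N.RightVanishAbove hP n) :
    f < ⊤ ↔ ∃ n, N.LeftVanishAbove hP n ∧ N.RightVanishAbove hP n := by
  refine ⟨fun h ↦ ?_, fun ⟨n, hn⟩ ↦ ((hf n).2 hn).trans_lt (ENat.natCast_lt_top n)⟩
  obtain ⟨n, rfl⟩ := ENat.ne_top_iff_exists.1 h.ne
  exact ⟨n, (hf n).1 le_rfl⟩

end NakayamaFunctor

end

end NakayamaGorenstein

/-! ### The equivalence and the equality of the four numbers -/

theorem mainTheorem1 {A : Type u} [Category.{v} A] [Abelian A]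
    [HasDerivedCategory.{w₁} A] [HasDerivedCategory.{w₂} Aᵒᵖ]
    (P : A ⥤ A) (hP : NakayamaGorenstein.IsGenerating P)
    (N : NakayamaGorenstein.NakayamaFunctor P) :
    ∃ (_ : NakayamaGorenstein.HasLeftDerived.{w₂} N.ν)
      (_ : NakayamaGorenstein.HasRightDerived.{w₁} N.νR),
      List.TFAE
        [NakayamaGorenstein.IsIwanagaGorenstein.{w₁, w₂} N,
          NakayamaGorenstein.globalResolutionDim
            (NakayamaGorenstein.IsGorensteinProjective N) < ⊤,
          NakayamaGorenstein.globalCoresolutionDim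
            (NakayamaGorenstein.IsGorensteinInjective N) < ⊤] ∧
      (NakayamaGorenstein.IsIwanagaGorenstein.{w₁, w₂} N →
        ∃ n : ℕ,
          NakayamaGorenstein.globalResolutionDim
            (NakayamaGorenstein.IsGorensteinProjective N) = n ∧
          NakayamaGorenstein.globalCoresolutionDim
            (NakayamaGorenstein.IsGorensteinInjective N) = n ∧
          IsLeast {s : ℕ | NakayamaGorenstein.LeftDerivedVanishAbove.{w₂} N s} n ∧
          IsLeast {t : ℕ | NakayamaGorenstein.RightDerivedVanishAbove.{w₁} N t} n) := by
  have hL : NakayamaGorenstein.HasLeftDerived.{w₂} N.ν := (N.leftEmbedding hP).hasRightDerived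
  have hR : NakayamaGorenstein.HasRightDerived.{w₁} N.νR := (N.rightEmbedding hP).hasRightDerived
  refine ⟨hL, hR, ?_, ?_⟩
  · rw [List.tfae_cons_cons, List.tfae_cons_cons,
      N.exists_vanishAbove_iff hP (N.globalResolutionDim_le_iff hP),
      N.exists_vanishAbove_iff hP (N.globalCoresolutionDim_le_iff hP)]
    simp only [NakayamaGorenstein.IsIwanagaGorenstein, N.leftDerivedVanishAbove_iff hP,
      N.rightDerivedVanishAbove_iff hP, List.tfae_singleton, and_self]
  · rintro ⟨m, hl, hr⟩
    rw [N.leftDerivedVanishAbove_iff hP] at hl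
    rw [N.rightDerivedVanishAbove_iff hP] at hr
    simp only [N.leftDerivedVanishAbove_iff hP, N.rightDerivedVanishAbove_iff hP]
    -- Once both functors have some bound `m`, their bounds coincide, so a single least bound serves
    -- all four numbers.
    have h (k : ℕ) : N.LeftVanishAbove hP k ↔ N.RightVanishAbove hP k :=
      ⟨fun h ↦ h.right hr, fun h ↦ h.left hl⟩
    classical
    have hn : IsLeast {s : ℕ | N.RightVanishAbove hP s} (Nat.find ⟨m, hr⟩) :=
      ⟨Nat.find_spec ⟨m, hr⟩, fun k hk ↦ Nat.find_min' _ hk⟩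
    simp only [h]
    exact ⟨_,
      NakayamaGorenstein.eq_natCast_of_isLeast (fun k ↦ by
        simp [N.globalResolutionDim_le_iff hP, h]) hn,
      NakayamaGorenstein.eq_natCast_of_isLeast (fun k ↦ by
        simp [N.globalCoresolutionDim_le_iff hP, h]) hn, hn, hn⟩
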